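/- Let $M$ be a connected smooth manifold of dimension $n\ge 3$, and let $A\subseteq TM\setminus\mathbf 0$ be open, conic ($(x,y)\in A$ and $\mu>0$ imply $(x,\mu y)\in A$) and such that every fiber $A\cap T_xM$ is non-empty. Let $L\colon A\to\mathbb R$ be a pseudo-Finsler metric: $L$ is smooth, $L(x,\mu y)=\mu^2L(x,y)$ for $\mu>0$, and the matrix $g_{ij}=\frac12\frac{\partial^2L}{\partial y^i\partial y^j}$ is non-degenerate at every point of $A$. In natural coordinates $(x^i,y^i)$ put $$G^i=\tfrac14 g^{ic}\Big(\frac{\partial g_{cb}}{\partial x^a}+\frac{\partial g_{ac}}{\partial x^b}-\frac{\partial g_{ab}}{\partial x^c}\Big)y^ay^b,$$ $$\mathrm{Ric}=2\frac{\partial G^i}{\partial x^i}-y^j\frac{\partial^2G^i}{\partial x^j\partial y^i}+2G^j\frac{\partial^2G^i}{\partial y^j\partial y^i}-\frac{\partial G^i}{\partial y^j}\frac{\partial G^j}{\partial y^i};$$ the Ricci scalar $\mathrm{Ric}$ does not depend on the coordinates and is a function on $A$. Suppose that $\mathrm{Ric}$ is quadratic, i.e. there is a smooth $2$-covariant tensor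 field $h$ on $M$ with $\mathrm{Ric}(x,y)=h_x(y,y)$ for all $(x,y)\in A$, and that $(M,L)$ is Einstein, i.e. there is a function $\rho\colon M\to\mathbb R$ with $\mathrm{Ric}(x,y)/L(x,y)=\rho(x)$ for all $(x,y)\in A$ with $L(x,y)\ne0$. Then at least one of the following holds: 1. $\mathrm{Ric}=0$ on all of $A$; 2. there are a pseudo-Riemannian metric $h$ on $M$ (a smooth symmetric non-degenerate $2$-covariant tensor field) with $L(x,y)=h_x(y,y)$ for all $(x,y)\in A$, and a constant $c\in\mathbb R$ with $\mathrm{Ric}=cL$ on all of $A$. -/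

import Mathlib

open scoped Manifold ContDiff

namespace PseudoFinsler

noncomputable section

/-! ### Coordinate expressions

For functions `f (x, y)` of `x, y ∈ ℝⁿ`, written in curried form. -/

/-- The partial derivative `∂f/∂xⁱ` at `(x, y)`. -/
def dx {n : ℕ} (i : Fin n) (f : EuclideanSpace ℝ (Fin n) → EuclideanSpace ℝ (Fin n) → ℝ)
    (x y : EuclideanSpace ℝ (Fin n)) : ℝ :=
  fderiv ℝ (fun x' => f x' y) x (EuclideanSpace.single i 1)

/-- The partial derivative `∂f/∂yⁱ` at `(x, y)`. -/
def dy {n : ℕ} (i : Fin n) (f : EuclideanSpace ℝ (Fin n) → EuclideanSpace ℝ (Fin n) → ℝ)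
    (x y : EuclideanSpace ℝ (Fin n)) : ℝ :=
  fderiv ℝ (fun y' => f x y') y (EuclideanSpace.single i 1)

/-- The matrix of the fundamental tensor, `g_ij = (1/2) ∂²L/∂yⁱ∂yʲ`. -/
def fundamental {n : ℕ} (L : EuclideanSpace ℝ (Fin n) → EuclideanSpace ℝ (Fin n) → ℝ)
    (x y : EuclideanSpace ℝ (Fin n)) : Matrix (Fin n) (Fin n) ℝ :=
  Matrix.of fun i j => (1 / 2 : ℝ) * dy i (dy j L) x y

/-- The spray coefficients
`Gⁱ = (1/4) gⁱᶜ (∂g_cb/∂xᵃ + ∂g_ac/∂xᵇ - ∂g_ab/∂xᶜ) yᵃ yᵇ`. -/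
def spray {n : ℕ} (L : EuclideanSpace ℝ (Fin n) → EuclideanSpace ℝ (Fin n) → ℝ) (i : Fin n)
    (x y : EuclideanSpace ℝ (Fin n)) : ℝ :=
  (1 / 4 : ℝ) * ∑ c, (fundamental L x y)⁻¹ i c * ∑ a, ∑ b,
    (dx a (fun x y => fundamental L x y c b) x y
      + dx b (fun x y => fundamental L x y a c) x y
      - dx c (fun x y => fundamental L x y a b) x y) * y a * y b

/-- The coordinate expression of the Ricci scalar,
`2 ∂Gⁱ/∂xⁱ - yʲ ∂²Gⁱ/∂xʲ∂yⁱ + 2 Gʲ ∂²Gⁱ/∂yʲ∂yⁱ - (∂Gⁱ/∂yʲ) (∂Gʲ/∂yⁱ)`. -/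
def coordRicci {n : ℕ} (L : EuclideanSpace ℝ (Fin n) → EuclideanSpace ℝ (Fin n) → ℝ)
    (x y : EuclideanSpace ℝ (Fin n)) : ℝ :=
  2 * ∑ i, dx i (spray L i) x y
    - ∑ i, ∑ j, y j * dx j (dy i (spray L i)) x y
    + 2 * ∑ i, ∑ j, spray L j x y * dy j (dy i (spray L i)) x y
    - ∑ i, ∑ j, dy j (spray L i) x y * dy i (spray L j) x y

/-! ### Natural charts of the tangent bundle -/

/-- The expression of a function `L` on `TM` in the natural coordinates `(xⁱ, yⁱ)` of `TM` induced by
a chart `e` of `M`: here `(x, y)` stands for the vector `yⁱ ∂/∂xⁱ` at the point `e.symm x`. -/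
def localExpr {n : ℕ} {M : Type*} [TopologicalSpace M]
    [ChartedSpace (EuclideanSpace ℝ (Fin n)) M]
    (e : OpenPartialHomeomorph M (EuclideanSpace ℝ (Fin n))) (L : TangentBundle (𝓡 n) M → ℝ)
    (x y : EuclideanSpace ℝ (Fin n)) : ℝ :=
  L ⟨e.symm x, mfderiv (𝓡 n) (𝓡 n) e.symm x y⟩

/-- The coordinates `(yⁱ)` of the tangent vector `v` in the natural chart induced by `e`. -/
def fiberCoord {n : ℕ} {M : Type*} [TopologicalSpace M]
    [ChartedSpace (EuclideanSpace ℝ (Fin n)) M]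
    (e : OpenPartialHomeomorph M (EuclideanSpace ℝ (Fin n))) (v : TangentBundle (𝓡 n) M) :
    EuclideanSpace ℝ (Fin n) :=
  mfderiv (𝓡 n) (𝓡 n) e v.proj v.snd

/-- The components `g_ij(x, y)` in the chart `e` of the fundamental tensor at `v = (x, y)`. -/
def fundamentalTensor {n : ℕ} {M : Type*} [TopologicalSpace M]
    [ChartedSpace (EuclideanSpace ℝ (Fin n)) M]
    (e : OpenPartialHomeomorph M (EuclideanSpace ℝ (Fin n))) (L : TangentBundle (𝓡 n) M → ℝ)
    (v : TangentBundle (𝓡 n) M) : Matrix (Fin n) (Fin n) ℝ :=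
  fundamental (localExpr e L) (e v.proj) (fiberCoord e v)

/-- The Ricci scalar `Ric(x, y)` at `v = (x, y)`, computed in the chart `e` around `x`. (Its value
is classically independent of the chart.) -/
def ricciScalar {n : ℕ} {M : Type*} [TopologicalSpace M]
    [ChartedSpace (EuclideanSpace ℝ (Fin n)) M]
    (e : OpenPartialHomeomorph M (EuclideanSpace ℝ (Fin n))) (L : TangentBundle (𝓡 n) M → ℝ)
    (v : TangentBundle (𝓡 n) M) : ℝ :=
  coordRicci (localExpr e L) (e v.proj) (fiberCoord e v)

/-- `f` is the coordinate-free function on `A` whose value at each vector of `A` is the Ricci scalar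
of `L`, in every chart of the smooth structure around its base point. -/
def RicciScalarEq {n : ℕ} {M : Type*} [TopologicalSpace M]
    [ChartedSpace (EuclideanSpace ℝ (Fin n)) M]
    (A : Set (TangentBundle (𝓡 n) M)) (L f : TangentBundle (𝓡 n) M → ℝ) : Prop :=
  ∀ e ∈ IsManifold.maximalAtlas (𝓡 n) ∞ M, ∀ v ∈ A, v.proj ∈ e.source →
    ricciScalar e L v = f v

/-! ### Pseudo-Finsler metrics -/

/-- `A ⊆ TM ∖ 0` is open and conic and projects onto `M`. -/
structure IsConicDomain {n : ℕ} {M : Type*} [TopologicalSpace M]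
    [ChartedSpace (EuclideanSpace ℝ (Fin n)) M] [IsManifold (𝓡 n) ∞ M]
    (A : Set (TangentBundle (𝓡 n) M)) : Prop where
  isOpen : IsOpen A
  ne_zero : ∀ v ∈ A, v.snd ≠ 0
  conic : ∀ v ∈ A, ∀ μ : ℝ, 0 < μ → (⟨v.proj, μ • v.snd⟩ : TangentBundle (𝓡 n) M) ∈ A
  surj : ∀ x : M, ∃ v ∈ A, v.proj = x

/-- `L` is a pseudo-Finsler metric defined on `A`: it is smooth on `A`, positively `2`-homogeneous,
and its fundamental tensor is non-degenerate on `A`. (The values of `L` outside `A` are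
irrelevant.) -/
structure IsPseudoFinslerMetric {n : ℕ} {M : Type*} [TopologicalSpace M]
    [ChartedSpace (EuclideanSpace ℝ (Fin n)) M] [IsManifold (𝓡 n) ∞ M]
    (A : Set (TangentBundle (𝓡 n) M)) (L : TangentBundle (𝓡 n) M → ℝ) : Prop where
  domain : IsConicDomain A
  smooth : ContMDiffOn (𝓡 n).tangent 𝓘(ℝ, ℝ) ∞ L A
  homogeneous : ∀ v ∈ A, ∀ μ : ℝ, 0 < μ → L ⟨v.proj, μ • v.snd⟩ = μ ^ 2 * L v
  nondegenerate : ∀ e ∈ IsManifold.maximalAtlas (𝓡 n) ∞ M, ∀ v ∈ A, v.proj ∈ e.source →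
    (fundamentalTensor e L v).det ≠ 0

/-- Smoothness of a `2`-covariant tensor field on `M`. -/
def IsSmoothTensorField {n : ℕ} {M : Type*} [TopologicalSpace M]
    [ChartedSpace (EuclideanSpace ℝ (Fin n)) M] [IsManifold (𝓡 n) ∞ M]
    (h : ∀ x : M, TangentSpace (𝓡 n) x →L[ℝ] TangentSpace (𝓡 n) x →L[ℝ] ℝ) : Prop :=
  ContMDiff (𝓡 n)
    ((𝓡 n).prod 𝓘(ℝ, EuclideanSpace ℝ (Fin n) →L[ℝ] EuclideanSpace ℝ (Fin n) →L[ℝ] ℝ)) ∞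
    (fun x => Bundle.TotalSpace.mk'
      (EuclideanSpace ℝ (Fin n) →L[ℝ] EuclideanSpace ℝ (Fin n) →L[ℝ] ℝ) x (h x))

/-- The Ricci scalar is quadratic: it is the restriction to `A` of `(x, y) ↦ h_x(y, y)` for some
`2`-covariant tensor field `h` on `M`. -/
def HasQuadraticRicci {n : ℕ} {M : Type*} [TopologicalSpace M]
    [ChartedSpace (EuclideanSpace ℝ (Fin n)) M] [IsManifold (𝓡 n) ∞ M]
    (A : Set (TangentBundle (𝓡 n) M)) (L : TangentBundle (𝓡 n) M → ℝ) : Prop :=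
  ∃ h : ∀ x : M, TangentSpace (𝓡 n) x →L[ℝ] TangentSpace (𝓡 n) x →L[ℝ] ℝ,
    IsSmoothTensorField h ∧ RicciScalarEq A L fun v => h v.proj v.snd v.snd

/-- `(M, L)` is Einstein: the Ricci curvature `Ric / L`, a function on `{v ∈ A | L v ≠ 0}`, depends
only on the base point. -/
def IsEinstein {n : ℕ} {M : Type*} [TopologicalSpace M]
    [ChartedSpace (EuclideanSpace ℝ (Fin n)) M]
    (A : Set (TangentBundle (𝓡 n) M)) (L : TangentBundle (𝓡 n) M → ℝ) : Prop :=
  ∃ ρ : M → ℝ, ∀ e ∈ IsManifold.maximalAtlas (𝓡 n) ∞ M, ∀ v ∈ A, v.proj ∈ e.source →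
    L v ≠ 0 → ricciScalar e L v / L v = ρ v.proj

/-- `L` is pseudo-Riemannian: it is the restriction to `A` of `(x, y) ↦ h_x(y, y)` for some
pseudo-Riemannian metric `h` (a smooth symmetric non-degenerate tensor field) on `M`. -/
def IsPseudoRiemannian {n : ℕ} {M : Type*} [TopologicalSpace M]
    [ChartedSpace (EuclideanSpace ℝ (Fin n)) M] [IsManifold (𝓡 n) ∞ M]
    (A : Set (TangentBundle (𝓡 n) M)) (L : TangentBundle (𝓡 n) M → ℝ) : Prop :=
  ∃ h : ∀ x : M, TangentSpace (𝓡 n) x →L[ℝ] TangentSpace (𝓡 n) x →L[ℝ] ℝ,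
    IsSmoothTensorField h ∧ (∀ x u w, h x u w = h x w u) ∧
      (∀ x u, (∀ w, h x u w = 0) → u = 0) ∧ ∀ v ∈ A, L v = h v.proj v.snd v.snd

end

end PseudoFinsler

/-! At a fixed point `x` the Einstein condition gives `h(y, y) = ρ(x) L(x, y)` wherever `L ≠ 0`.
Since `L` cannot vanish on an open piece of a fiber (its fundamental tensor would be zero there),
the identity extends by continuity to all of `A` (`tensor_eq_mul`). Hence `ρ` is smooth, being
locally a quotient `h(y, y) / L(x, y)` with constant components `y` (`contDiffAt_factor`).

If `ρ` vanishes identically, so does the Ricci scalar. Otherwise, near a point with `ρ ≠ 0`, `L = h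
/ ρ` is quadratic in `y`: its matrix is the symmetric part of `h / ρ`, and it is non-degenerate
because the fundamental tensor of `L` is. The Ricci scalar is then the quadratic form of the usual
Ricci tensor (`coordRicci_quadForm`), so the metric is Einstein in the classical sense and Schur's
lemma for `n ≥ 3` gives `dρ = 0` (`schur_of_critical`, `pd_factor_eq_zero`). A nonzero value of `ρ`
is thus attained on an open and closed set, which is all of `M` by connectedness. So `ρ` is a
nonzero constant `c`, and `L` is the symmetric part of `h / c`.

Schur's lemma is proved without covariant derivatives. At a point where the first derivatives of the
metric vanish, the derivative of the Ricci tensor is linear in the third derivatives of the metric,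
and the contracted Bianchi identity becomes index algebra (`contracted_bianchi`). Such coordinates
come from a quadratic change of variables built from the Christoffel symbols
(`pd_pullback_eq_zero`). The Ricci hypothesis is available in every chart of the maximal atlas,
hence in the new one, so no transformation law for `coordRicci` is needed. -/

namespace PseudoFinsler

open Filter Topology

/-! ### Partial derivatives -/

/-- The partial derivative `∂f/∂xⁱ` of a function on `ℝⁿ`. -/
noncomputable def pd {n : ℕ} (i : Fin n) (f : EuclideanSpace ℝ (Fin n) → ℝ)
    (x : EuclideanSpace ℝ (Fin n)) : ℝ :=
  fderiv ℝ f x (EuclideanSpace.single i 1)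

section PartialDerivatives

variable {n : ℕ} {f g : EuclideanSpace ℝ (Fin n) → ℝ} {x : EuclideanSpace ℝ (Fin n)}

theorem dx_eq_pd (i : Fin n) (f : EuclideanSpace ℝ (Fin n) → EuclideanSpace ℝ (Fin n) → ℝ)
    (x y : EuclideanSpace ℝ (Fin n)) : dx i f x y = pd i (fun x' => f x' y) x := rfl

theorem dy_eq_pd (i : Fin n) (f : EuclideanSpace ℝ (Fin n) → EuclideanSpace ℝ (Fin n) → ℝ)
    (x y : EuclideanSpace ℝ (Fin n)) : dy i f x y = pd i (fun y' => f x y') y := rfl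

theorem pd_congr (h : f =ᶠ[𝓝 x] g) (i : Fin n) : pd i f x = pd i g x := by
  rw [pd, pd, h.fderiv_eq]

theorem pd_eventuallyEq (h : f =ᶠ[𝓝 x] g) (i : Fin n) : pd i f =ᶠ[𝓝 x] pd i g := by
  filter_upwards [h.eventuallyEq_nhds] with z hz using pd_congr hz i

@[simp]
theorem pd_const (i : Fin n) (c : ℝ) : pd i (fun _ => c) x = 0 := by
  simp [pd]

theorem pd_add (i : Fin n) (hf : DifferentiableAt ℝ f x) (hg : DifferentiableAt ℝ g x) :
    pd i (fun z => f z + g z) x = pd i f x + pd i g x := by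
  simp only [pd]; rw [fderiv_fun_add hf hg]; rfl

theorem pd_sub (i : Fin n) (hf : DifferentiableAt ℝ f x) (hg : DifferentiableAt ℝ g x) :
    pd i (fun z => f z - g z) x = pd i f x - pd i g x := by
  simp only [pd]; rw [fderiv_fun_sub hf hg]; rfl

theorem pd_mul (i : Fin n) (hf : DifferentiableAt ℝ f x) (hg : DifferentiableAt ℝ g x) :
    pd i (fun z => f z * g z) x = pd i f x * g x + f x * pd i g x := by
  simp only [pd]; rw [fderiv_fun_mul hf hg]; simp; ring

theorem pd_const_mul (i : Fin n) (c : ℝ) (hf : DifferentiableAt ℝ f x) :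
    pd i (fun z => c * f z) x = c * pd i f x := by
  rw [pd_mul i (by fun_prop) hf]; simp

theorem pd_mul_const (i : Fin n) (c : ℝ) (hf : DifferentiableAt ℝ f x) :
    pd i (fun z => f z * c) x = pd i f x * c := by
  rw [pd_mul i hf (by fun_prop)]; simp

theorem pd_sum {ι : Type*} (s : Finset ι) (i : Fin n) {f : ι → EuclideanSpace ℝ (Fin n) → ℝ}
    (hf : ∀ a ∈ s, DifferentiableAt ℝ (f a) x) :
    pd i (fun z => ∑ a ∈ s, f a z) x = ∑ a ∈ s, pd i (f a) x := by
  simp only [pd]; rw [fderiv_fun_sum hf]; simp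

theorem pd_coord (i a : Fin n) : pd i (fun z => z a) x = if a = i then 1 else 0 := by
  have : (fun z : EuclideanSpace ℝ (Fin n) => z a) = EuclideanSpace.proj (𝕜 := ℝ) a := rfl
  rw [pd, this, ContinuousLinearMap.fderiv]
  simp

theorem contDiffAt_pd (hf : ContDiffAt ℝ ∞ f x) (i : Fin n) : ContDiffAt ℝ ∞ (pd i f) x :=
  (hf.fderiv_right (m := ∞) (by simp)).clm_apply contDiffAt_const

theorem eventually_differentiableAt (hf : ContDiffAt ℝ ∞ f x) :
    ∀ᶠ z in 𝓝 x, DifferentiableAt ℝ f z := by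
  have h1 : ContDiffAt ℝ 1 f x := hf.of_le (by simp)
  filter_upwards [h1.eventually (by simp)] with z hz using hz.differentiableAt (by simp)

theorem differentiableAt_of_smooth (hf : ContDiffAt ℝ ∞ f x) : DifferentiableAt ℝ f x :=
  hf.differentiableAt (by simp)

theorem contDiffAt_two (hf : ContDiffAt ℝ ∞ f x) : ContDiffAt ℝ 2 f x :=
  hf.of_le (WithTop.coe_le_coe.2 (le_top : (2 : ℕ∞) ≤ ⊤))

theorem pd_comm (hf : ContDiffAt ℝ 2 f x) (i j : Fin n) : pd i (pd j f) x = pd j (pd i f) x := by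
  have hs : IsSymmSndFDerivAt ℝ f x := hf.isSymmSndFDerivAt (by simp)
  have hd : DifferentiableAt ℝ (fderiv ℝ f) x :=
    (hf.fderiv_right (m := 1) (by norm_num)).differentiableAt (by simp)
  have key : ∀ k l : Fin n, pd k (pd l f) x =
      fderiv ℝ (fderiv ℝ f) x (EuclideanSpace.single k 1) (EuclideanSpace.single l 1) := by
    intro k l
    change fderiv ℝ (fun z => fderiv ℝ f z (EuclideanSpace.single l 1)) x _ = _
    rw [fderiv_clm_apply hd (by fun_prop)]
    simp
  rw [key, key]
  exact hs.eq _ _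

/-- If `u` is critical and `v` vanishes at `x`, then `∂ₖ∂ₗ(uv) = u ∂ₖ∂ₗv` at `x`. -/
theorem pd_pd_mul_of_critical (hf : ContDiffAt ℝ ∞ f x) (hg : ContDiffAt ℝ ∞ g x)
    (hf0 : ∀ j, pd j f x = 0) (hg0 : g x = 0) (k l : Fin n) :
    pd k (pd l fun z => f z * g z) x = f x * pd k (pd l g) x := by
  have h1 : (pd l fun z => f z * g z) =ᶠ[𝓝 x] fun z => pd l f z * g z + f z * pd l g z := by
    filter_upwards [eventually_differentiableAt hf, eventually_differentiableAt hg] with z h1 h2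
      using pd_mul l h1 h2
  have df := differentiableAt_of_smooth hf
  have dg := differentiableAt_of_smooth hg
  have dpf := differentiableAt_of_smooth (contDiffAt_pd hf l)
  have dpg := differentiableAt_of_smooth (contDiffAt_pd hg l)
  rw [pd_congr h1, pd_add k (dpf.fun_mul dg) (df.fun_mul dpg), pd_mul k dpf dg, pd_mul k df dpg,
    hf0, hf0, hg0]
  ring

theorem pd_bilin (B : Fin n → Fin n → ℝ) (j : Fin n) (y : EuclideanSpace ℝ (Fin n)) :
    pd j (fun y => ∑ a, ∑ b, B a b * y a * y b) y = ∑ b, (B j b + B b j) * y b := by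
  have hc : ∀ a : Fin n, DifferentiableAt ℝ (fun z : EuclideanSpace ℝ (Fin n) => z a) y :=
    fun a => by fun_prop
  rw [pd_sum _ _ (fun a _ => by fun_prop)]
  have : ∀ a, pd j (fun y : EuclideanSpace ℝ (Fin n) => ∑ b, B a b * y a * y b) y =
      ∑ b, ((if a = j then B a b * y b else 0) + if b = j then B a b * y a else 0) := by
    intro a
    rw [pd_sum _ _ (fun b _ => by fun_prop)]
    refine Finset.sum_congr rfl fun b _ => ?_
    rw [pd_mul j (by fun_prop) (hc b), pd_const_mul j _ (hc a), pd_coord, pd_coord]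
    split_ifs <;> ring
  simp_rw [this, Finset.sum_add_distrib, add_mul]
  rw [Finset.sum_comm, Finset.sum_add_distrib]
  simp

theorem pd_lin (B : Fin n → ℝ) (j : Fin n) (y : EuclideanSpace ℝ (Fin n)) :
    pd j (fun y => ∑ a, B a * y a) y = B j := by
  rw [pd_sum _ _ (fun a _ => by fun_prop)]
  have : ∀ a, pd j (fun y : EuclideanSpace ℝ (Fin n) => B a * y a) y = if a = j then B a else 0 := by
    intro a
    rw [pd_const_mul j _ (by fun_prop), pd_coord]
    split_ifs <;> ring
  simp [this]

/-- A quadratic form vanishing on an open set has vanishing symmetric part. -/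
theorem symm_eq_zero_of_eventually (B : Fin n → Fin n → ℝ) (y₀ : EuclideanSpace ℝ (Fin n))
    (h : ∀ᶠ y in 𝓝 y₀, ∑ a, ∑ b, B a b * y a * y b = 0) (i j : Fin n) : B i j + B j i = 0 := by
  have h1 : (fun y : EuclideanSpace ℝ (Fin n) => ∑ a, ∑ b, B a b * y a * y b) =ᶠ[𝓝 y₀]
    fun _ => 0 := h
  -- Two derivatives of the form recover the symmetrized coefficients, and they only depend on its
  -- germ at `y₀`.
  have h2 := pd_congr (pd_eventuallyEq h1 i) j
  have h3 : (pd i fun y : EuclideanSpace ℝ (Fin n) => ∑ a, ∑ b, B a b * y a * y b) =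
      fun y => ∑ b, (B i b + B b i) * y b := funext fun y => pd_bilin B i y
  rw [h3, pd_lin] at h2
  rw [h2, show (pd i fun _ : EuclideanSpace ℝ (Fin n) => (0 : ℝ)) = fun _ => 0 from
    funext fun _ => pd_const i 0, pd_const]

end PartialDerivatives

/-! ### Locality of the Ricci scalar -/

section Locality

variable {n : ℕ} {L L' : EuclideanSpace ℝ (Fin n) → EuclideanSpace ℝ (Fin n) → ℝ}
  {q : EuclideanSpace ℝ (Fin n) × EuclideanSpace ℝ (Fin n)}

/-- `L` and `L'` agree in a neighbourhood of `q`. -/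
def EqNear (L L' : EuclideanSpace ℝ (Fin n) → EuclideanSpace ℝ (Fin n) → ℝ)
    (q : EuclideanSpace ℝ (Fin n) × EuclideanSpace ℝ (Fin n)) : Prop :=
  ∀ᶠ r in 𝓝 q, L r.1 r.2 = L' r.1 r.2

/-- Agreement is required jointly in `(x, y)`, so that it survives any alternation of `dx` and `dy`.
-/
theorem EqNear.dx (h : EqNear L L' q) (i : Fin n) : EqNear (dx i L) (dx i L') q := by
  filter_upwards [h.eventually_nhds] with r hr
  have hc : Tendsto (fun x' => (x', r.2)) (𝓝 r.1) (𝓝 r) :=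
    (Continuous.prodMk_left r.2).tendsto' _ _ rfl
  exact pd_congr (hc.eventually hr) i

theorem EqNear.dy (h : EqNear L L' q) (i : Fin n) : EqNear (dy i L) (dy i L') q := by
  filter_upwards [h.eventually_nhds] with r hr
  have hc : Tendsto (fun y' => (r.1, y')) (𝓝 r.2) (𝓝 r) :=
    (Continuous.prodMk_right r.1).tendsto' _ _ rfl
  exact pd_congr (hc.eventually hr) i

theorem EqNear.fundamental (h : EqNear L L' q) :
    ∀ᶠ r in 𝓝 q, fundamental L r.1 r.2 = fundamental L' r.1 r.2 := by
  have h1 : ∀ i j, EqNear (PseudoFinsler.dy i (PseudoFinsler.dy j L))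
    (PseudoFinsler.dy i (PseudoFinsler.dy j L')) q := fun i j => (h.dy j).dy i
  simp only [EqNear, ← eventually_all] at h1
  filter_upwards [h1] with r hr
  ext i j
  simp [PseudoFinsler.fundamental, hr]

theorem EqNear.spray (h : EqNear L L' q) (i : Fin n) : EqNear (spray L i) (spray L' i) q := by
  have h0 := h.fundamental
  have h1 : ∀ k a b, EqNear (PseudoFinsler.dx k fun x y => PseudoFinsler.fundamental L x y a b)
      (PseudoFinsler.dx k fun x y => PseudoFinsler.fundamental L' x y a b) q := fun k a b =>
    EqNear.dx (h0.mono fun r hr => by rw [hr]) k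
  simp only [EqNear, ← eventually_all] at h1
  filter_upwards [h0, h1] with r hr hr'
  simp only [PseudoFinsler.spray, hr, hr']

/-- This allows `L` to be replaced by a quadratic form that agrees with it only near one vector of
the domain. -/
theorem EqNear.coordRicci (h : EqNear L L' q) : EqNear (coordRicci L) (coordRicci L') q := by
  have h0 : ∀ i, EqNear (PseudoFinsler.spray L i) (PseudoFinsler.spray L' i) q := h.spray
  have h1 := fun i j => (h0 i).dx j
  have h2 := fun i j => (h0 i).dy j
  have h3 := fun i j k => (h2 i j).dx k
  have h4 := fun i j k => (h2 i j).dy k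
  simp only [EqNear, ← eventually_all] at h0 h1 h2 h3 h4
  filter_upwards [h0, h1, h2, h3, h4] with r h0 h1 h2 h3 h4
  simp only [PseudoFinsler.coordRicci, h0, h1, h2, h3, h4]

end Locality

/-! ### The Ricci scalar of a quadratic metric -/

section Quadratic

variable {n : ℕ}

/-- The function `g_ab(x) yᵃ yᵇ`. -/
noncomputable def quadForm (g : EuclideanSpace ℝ (Fin n) → Matrix (Fin n) (Fin n) ℝ)
    (x y : EuclideanSpace ℝ (Fin n)) : ℝ :=
  ∑ a, ∑ b, g x a b * y a * y b

/-- The Christoffel symbols of the first kind. -/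
noncomputable def christoffelLow (g : EuclideanSpace ℝ (Fin n) → Matrix (Fin n) (Fin n) ℝ)
    (c a b : Fin n) (x : EuclideanSpace ℝ (Fin n)) : ℝ :=
  (1 / 2 : ℝ) * (pd a (fun x => g x c b) x + pd b (fun x => g x a c) x - pd c (fun x => g x a b) x)

/-- The Christoffel symbols of the second kind. -/
noncomputable def christoffel (g : EuclideanSpace ℝ (Fin n) → Matrix (Fin n) (Fin n) ℝ)
    (i a b : Fin n) (x : EuclideanSpace ℝ (Fin n)) : ℝ :=
  ∑ c, (g x)⁻¹ i c * christoffelLow g c a b x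

/-- The (a priori non-symmetric) coefficients of the Ricci tensor. -/
noncomputable def ricciTensor (g : EuclideanSpace ℝ (Fin n) → Matrix (Fin n) (Fin n) ℝ)
    (a b : Fin n) (x : EuclideanSpace ℝ (Fin n)) : ℝ :=
  ∑ i, (pd i (christoffel g i a b) x - pd a (christoffel g i i b) x
    + ∑ j, (christoffel g j a b x * christoffel g i i j x
      - christoffel g i j a x * christoffel g j i b x))

variable {g : EuclideanSpace ℝ (Fin n) → Matrix (Fin n) (Fin n) ℝ}

theorem dy_dy_quadForm (g : EuclideanSpace ℝ (Fin n) → Matrix (Fin n) (Fin n) ℝ)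
    (x y : EuclideanSpace ℝ (Fin n)) (i j : Fin n) :
    dy i (dy j (quadForm g)) x y = g x j i + g x i j := by
  have : (fun y => dy j (quadForm g) x y) = fun y => ∑ b, (g x j b + g x b j) * y b :=
    funext fun y => pd_bilin (fun a b => g x a b) j y
  rw [dy_eq_pd, this, pd_lin]

theorem fundamental_quadForm (hg : ∀ x, (g x).IsSymm) :
    fundamental (quadForm g) = fun x _ => g x := by
  ext x y i j
  rw [fundamental, Matrix.of_apply, dy_dy_quadForm, (hg x).apply i j]
  ring

theorem christoffelLow_comm (hg : ∀ x, (g x).IsSymm) (c a b : Fin n) :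
    christoffelLow g c a b = christoffelLow g c b a := by
  ext x
  have h : ∀ a b, (fun x => g x a b) = fun x => g x b a := fun a b =>
    funext fun x => (hg x).apply b a
  rw [christoffelLow, christoffelLow, h c b, h a c, h a b]
  ring

theorem christoffel_comm (hg : ∀ x, (g x).IsSymm) (i a b : Fin n) :
    christoffel g i a b = christoffel g i b a := by
  ext x
  simp only [christoffel, christoffelLow_comm hg _ a b]

theorem spray_quadForm (hg : ∀ x, (g x).IsSymm) (i : Fin n) :
    spray (quadForm g) i = fun x y => ∑ a, ∑ b, (1 / 2 * christoffel g i a b x) * y a * y b := by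
  ext x y
  simp only [spray, fundamental_quadForm hg, dx_eq_pd, christoffel, christoffelLow, Finset.mul_sum,
    Finset.sum_mul]
  rw [Finset.sum_comm]
  refine Finset.sum_congr rfl fun a _ => ?_
  rw [Finset.sum_comm]
  refine Finset.sum_congr rfl fun b _ => Finset.sum_congr rfl fun c _ => ?_
  ring

theorem dy_spray_quadForm (hg : ∀ x, (g x).IsSymm) (i j : Fin n) :
    dy j (spray (quadForm g) i) = fun x y => ∑ b, christoffel g i j b x * y b := by
  ext x y
  rw [spray_quadForm hg, dy_eq_pd, pd_bilin (fun a b => 1 / 2 * christoffel g i a b x)]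
  refine Finset.sum_congr rfl fun b _ => ?_
  rw [christoffel_comm hg i b j]
  ring

theorem dy_dy_spray_quadForm (hg : ∀ x, (g x).IsSymm) (i j k : Fin n) :
    dy k (dy j (spray (quadForm g) i)) = fun x _ => christoffel g i j k x := by
  ext x y
  rw [dy_spray_quadForm hg, dy_eq_pd, pd_lin]

/-- The spray is `(1/2) Γⁱ_ab yᵃ yᵇ`, so each of the four terms of `coordRicci` is itself a
quadratic form in `y`. They are computed separately as `e1`, ..., `e4`, and their coefficients add
up to the Ricci tensor. -/
theorem coordRicci_quadForm (hg : ∀ x, (g x).IsSymm) {x : EuclideanSpace ℝ (Fin n)}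
    (hΓ : ∀ i a b, DifferentiableAt ℝ (christoffel g i a b) x) (y : EuclideanSpace ℝ (Fin n)) :
    coordRicci (quadForm g) x y = ∑ a, ∑ b, ricciTensor g a b x * y a * y b := by
  have h1 : ∀ i, dx i (spray (quadForm g) i) x y =
      ∑ a, ∑ b, (1 / 2 * pd i (christoffel g i a b) x) * y a * y b := by
    intro i
    rw [spray_quadForm hg, dx_eq_pd, pd_sum _ _ fun a _ => ?_]
    · refine Finset.sum_congr rfl fun a _ => ?_
      rw [pd_sum _ _ fun b _ => ?_]
      · refine Finset.sum_congr rfl fun b _ => ?_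
        have := hΓ i a b
        rw [pd_mul_const _ _ (by fun_prop), pd_mul_const _ _ (by fun_prop), pd_const_mul _ _ this]
      · have := hΓ i a b
        fun_prop
    · have := hΓ i a
      fun_prop
  have h2 : ∀ i j, dx j (dy i (spray (quadForm g) i)) x y =
      ∑ b, pd j (christoffel g i i b) x * y b := by
    intro i j
    rw [dy_spray_quadForm hg, dx_eq_pd, pd_sum _ _ fun b _ => ?_]
    · exact Finset.sum_congr rfl fun b _ => pd_mul_const _ _ (hΓ i i b)
    · have := hΓ i i b
      fun_prop
  have e1 : 2 * ∑ i, dx i (spray (quadForm g) i) x y =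
      ∑ a, ∑ b, (∑ i, pd i (christoffel g i a b) x) * y a * y b := by
    simp only [h1, Finset.mul_sum, Finset.sum_mul]
    rw [Finset.sum_comm]
    refine Finset.sum_congr rfl fun a _ => ?_
    rw [Finset.sum_comm]
    refine Finset.sum_congr rfl fun b _ => Finset.sum_congr rfl fun c _ => ?_
    ring
  have e2 : ∑ i, ∑ j, y j * dx j (dy i (spray (quadForm g) i)) x y =
      ∑ a, ∑ b, (∑ i, pd a (christoffel g i i b) x) * y a * y b := by
    simp only [h2, Finset.mul_sum, Finset.sum_mul]
    rw [Finset.sum_comm]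
    refine Finset.sum_congr rfl fun a _ => ?_
    rw [Finset.sum_comm]
    refine Finset.sum_congr rfl fun b _ => Finset.sum_congr rfl fun c _ => ?_
    ring
  have e3 : 2 * ∑ i, ∑ j, spray (quadForm g) j x y * dy j (dy i (spray (quadForm g) i)) x y =
      ∑ a, ∑ b, (∑ i, ∑ j, christoffel g j a b x * christoffel g i i j x) * y a * y b := by
    simp only [dy_dy_spray_quadForm hg]
    simp only [spray_quadForm hg, Finset.mul_sum, Finset.sum_mul]
    calc _ = ∑ i, ∑ a, ∑ j, ∑ b, 2 * ((1 / 2 * christoffel g j a b x) * y a * y b *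
          christoffel g i i j x) := Finset.sum_congr rfl fun i _ => Finset.sum_comm
      _ = ∑ a, ∑ i, ∑ j, ∑ b, 2 * ((1 / 2 * christoffel g j a b x) * y a * y b *
          christoffel g i i j x) := Finset.sum_comm
      _ = ∑ a, ∑ i, ∑ b, ∑ j, 2 * ((1 / 2 * christoffel g j a b x) * y a * y b *
          christoffel g i i j x) := Finset.sum_congr rfl fun a _ => Finset.sum_congr rfl fun i _ =>
            Finset.sum_comm
      _ = ∑ a, ∑ b, ∑ i, ∑ j, 2 * ((1 / 2 * christoffel g j a b x) * y a * y b *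
          christoffel g i i j x) := Finset.sum_congr rfl fun a _ => Finset.sum_comm
      _ = _ := Finset.sum_congr rfl fun a _ => Finset.sum_congr rfl fun b _ =>
            Finset.sum_congr rfl fun i _ => Finset.sum_congr rfl fun j _ => by ring
  have e4 : ∑ i, ∑ j, dy j (spray (quadForm g) i) x y * dy i (spray (quadForm g) j) x y =
      ∑ a, ∑ b, (∑ i, ∑ j, christoffel g i j a x * christoffel g j i b x) * y a * y b := by
    simp only [dy_spray_quadForm hg, Finset.sum_mul_sum]
    simp only [Finset.sum_mul]
    calc _ = ∑ i, ∑ a, ∑ j, ∑ b, christoffel g i j a x * y a * (christoffel g j i b x * y b) :=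
          Finset.sum_congr rfl fun i _ => Finset.sum_comm
      _ = ∑ a, ∑ i, ∑ j, ∑ b, christoffel g i j a x * y a * (christoffel g j i b x * y b) :=
          Finset.sum_comm
      _ = ∑ a, ∑ i, ∑ b, ∑ j, christoffel g i j a x * y a * (christoffel g j i b x * y b) :=
          Finset.sum_congr rfl fun a _ => Finset.sum_congr rfl fun i _ => Finset.sum_comm
      _ = ∑ a, ∑ b, ∑ i, ∑ j, christoffel g i j a x * y a * (christoffel g j i b x * y b) :=
          Finset.sum_congr rfl fun a _ => Finset.sum_comm
      _ = _ := Finset.sum_congr rfl fun a _ => Finset.sum_congr rfl fun b _ =>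
            Finset.sum_congr rfl fun i _ => Finset.sum_congr rfl fun j _ => by ring
  rw [coordRicci, e1, e2, e3, e4]
  simp only [← Finset.sum_sub_distrib, ← Finset.sum_add_distrib]
  refine Finset.sum_congr rfl fun a _ => Finset.sum_congr rfl fun b _ => ?_
  simp only [ricciTensor, Finset.sum_sub_distrib, Finset.sum_add_distrib]
  ring

end Quadratic

/-! ### Schur's lemma at a point where the first derivatives of the metric vanish -/

section Schur

variable {n : ℕ} {g : EuclideanSpace ℝ (Fin n) → Matrix (Fin n) (Fin n) ℝ}
  {p : EuclideanSpace ℝ (Fin n)}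

theorem contDiffAt_det (hg : ∀ a b, ContDiffAt ℝ ∞ (fun x => g x a b) p) :
    ContDiffAt ℝ ∞ (fun x => (g x).det) p := by
  simp only [Matrix.det_apply]
  refine ContDiffAt.sum fun σ _ => ContDiffAt.const_smul _ ?_
  exact contDiffAt_prod fun i _ => hg _ _

/-- Cramer's rule: an entry of the inverse is an entry of the adjugate, a determinant in the
entries, divided by `det g`. -/
theorem contDiffAt_inv (hg : ∀ a b, ContDiffAt ℝ ∞ (fun x => g x a b) p) (hdet : (g p).det ≠ 0)
    (a b : Fin n) : ContDiffAt ℝ ∞ (fun x => (g x)⁻¹ a b) p := by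
  have h1 : ContDiffAt ℝ ∞ (fun x => (g x).adjugate a b) p := by
    simp only [Matrix.adjugate_apply]
    refine contDiffAt_det fun i j => ?_
    by_cases h : i = b
    · subst h
      simpa using contDiffAt_const
    · simpa [Matrix.updateRow_ne h] using hg i j
  have h2 : (fun x => (g x)⁻¹ a b) = fun x => ((g x).det)⁻¹ * (g x).adjugate a b := by
    ext x
    simp [Matrix.inv_def]
  rw [h2]
  exact ((contDiffAt_det hg).inv hdet).mul h1

theorem contDiffAt_christoffelLow (hg : ∀ a b, ContDiffAt ℝ ∞ (fun x => g x a b) p)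
    (c a b : Fin n) : ContDiffAt ℝ ∞ (christoffelLow g c a b) p :=
  contDiffAt_const.mul (((contDiffAt_pd (hg c b) a).add (contDiffAt_pd (hg a c) b)).sub
    (contDiffAt_pd (hg a b) c))

theorem contDiffAt_christoffel (hg : ∀ a b, ContDiffAt ℝ ∞ (fun x => g x a b) p)
    (hdet : (g p).det ≠ 0) (i a b : Fin n) : ContDiffAt ℝ ∞ (christoffel g i a b) p :=
  ContDiffAt.sum fun c _ => (contDiffAt_inv hg hdet i c).mul (contDiffAt_christoffelLow hg c a b)

/-- Differentiate `g⁻¹ g = 1`, valid near `p`, and cancel the invertible matrix `g p`. -/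
theorem pd_inv_eq_zero (hg : ∀ a b, ContDiffAt ℝ ∞ (fun x => g x a b) p) (hdet : (g p).det ≠ 0)
    (hcrit : ∀ a b k, pd k (fun x => g x a b) p = 0) (a b k : Fin n) :
    pd k (fun x => (g x)⁻¹ a b) p = 0 := by
  have hi := fun a b => differentiableAt_of_smooth (contDiffAt_inv hg hdet a b)
  have hd := fun a b => differentiableAt_of_smooth (hg a b)
  have hev : ∀ᶠ x in 𝓝 p, (g x).det ≠ 0 := (contDiffAt_det hg).continuousAt.eventually_ne hdet
  have h1 : (Matrix.of fun a b => pd k (fun x => (g x)⁻¹ a b) p) * g p = 0 := by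
    ext a b
    have h2 : (fun x => ∑ c, (g x)⁻¹ a c * g x c b) =ᶠ[𝓝 p]
        fun _ => (1 : Matrix (Fin n) (Fin n) ℝ) a b := by
      filter_upwards [hev] with x hx
      rw [← Matrix.mul_apply, Matrix.nonsing_inv_mul _ (Ne.isUnit hx)]
    have h3 := pd_congr h2 k
    rw [pd_const, pd_sum _ _ fun c _ => (hi a c).fun_mul (hd c b)] at h3
    rw [Matrix.mul_apply, Matrix.zero_apply, ← h3]
    refine Finset.sum_congr rfl fun c _ => ?_
    rw [pd_mul k (hi a c) (hd c b), hcrit]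
    simp
  have h2 := congrArg (· * (g p)⁻¹) h1
  simp only [Matrix.mul_assoc, Matrix.mul_nonsing_inv _ (Ne.isUnit hdet), mul_one,
    zero_mul] at h2
  exact congrFun (congrFun h2 a) b

theorem pd_mul_eq_zero {u v : EuclideanSpace ℝ (Fin n) → ℝ} (hu : DifferentiableAt ℝ u p)
    (hv : DifferentiableAt ℝ v p) (hu0 : u p = 0) (hv0 : v p = 0) (k : Fin n) :
    pd k (fun x => u x * v x) p = 0 := by
  rw [pd_mul k hu hv, hu0, hv0]
  ring

theorem christoffelLow_eq_zero (hcrit : ∀ a b k, pd k (fun x => g x a b) p = 0) (c a b : Fin n) :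
    christoffelLow g c a b p = 0 := by
  simp [christoffelLow, hcrit]

theorem christoffel_eq_zero (hcrit : ∀ a b k, pd k (fun x => g x a b) p = 0) (i a b : Fin n) :
    christoffel g i a b p = 0 := by
  simp [christoffel, christoffelLow_eq_zero hcrit]

/-- At `p` the inverse metric is critical and the lowered symbols vanish, so both derivatives must
fall on the lowered symbols. -/
theorem pd_pd_christoffel (hg : ∀ a b, ContDiffAt ℝ ∞ (fun x => g x a b) p)
    (hdet : (g p).det ≠ 0) (hcrit : ∀ a b k, pd k (fun x => g x a b) p = 0) (i a b k l : Fin n) :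
    pd k (pd l (christoffel g i a b)) p =
      ∑ c, (g p)⁻¹ i c * pd k (pd l (christoffelLow g c a b)) p := by
  have hi := fun c => contDiffAt_inv hg hdet i c
  have hl := fun c => contDiffAt_christoffelLow hg c a b
  have h1 : pd l (christoffel g i a b) =ᶠ[𝓝 p]
      fun x => ∑ c, pd l (fun x => (g x)⁻¹ i c * christoffelLow g c a b x) x := by
    have h2 := fun c => eventually_differentiableAt ((hi c).mul (hl c))
    rw [← eventually_all] at h2
    filter_upwards [h2] with x hx
    exact pd_sum _ _ fun c _ => hx c
  rw [pd_congr h1, pd_sum _ _ fun c _ =>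
    differentiableAt_of_smooth (contDiffAt_pd ((hi c).mul (hl c)) l)]
  exact Finset.sum_congr rfl fun c _ => pd_pd_mul_of_critical (hi c) (hl c)
    (fun j => pd_inv_eq_zero hg hdet hcrit i c j) (christoffelLow_eq_zero hcrit c a b) k l

theorem pd_pd_christoffelLow (hg : ∀ a b, ContDiffAt ℝ ∞ (fun x => g x a b) p) (c a b k l : Fin n) :
    pd k (pd l (christoffelLow g c a b)) p =
      1 / 2 * (pd k (pd l (pd a fun x => g x c b)) p + pd k (pd l (pd b fun x => g x a c)) p
        - pd k (pd l (pd c fun x => g x a b)) p) := by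
  have h1 := contDiffAt_pd (hg c b) a
  have h2 := contDiffAt_pd (hg a c) b
  have h3 := contDiffAt_pd (hg a b) c
  have h4 : pd l (christoffelLow g c a b) =ᶠ[𝓝 p] fun x =>
      1 / 2 * (pd l (pd a fun x => g x c b) x + pd l (pd b fun x => g x a c) x
        - pd l (pd c fun x => g x a b) x) := by
    filter_upwards [eventually_differentiableAt h1, eventually_differentiableAt h2,
      eventually_differentiableAt h3] with x d1 d2 d3
    change pd l (fun x => 1 / 2 * (pd a (fun x => g x c b) x + pd b (fun x => g x a c) x
      - pd c (fun x => g x a b) x)) x = _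
    rw [pd_const_mul _ _ ((d1.fun_add d2).fun_sub d3), pd_sub _ (d1.fun_add d2) d3, pd_add _ d1 d2]
  have d1 := differentiableAt_of_smooth (contDiffAt_pd h1 l)
  have d2 := differentiableAt_of_smooth (contDiffAt_pd h2 l)
  have d3 := differentiableAt_of_smooth (contDiffAt_pd h3 l)
  rw [pd_congr h4, pd_const_mul _ _ ((d1.fun_add d2).fun_sub d3), pd_sub _ (d1.fun_add d2) d3,
    pd_add _ d1 d2]

/-- The products `ΓΓ` contribute nothing, since both factors vanish at `p`. -/
theorem pd_ricciTensor (hg : ∀ a b, ContDiffAt ℝ ∞ (fun x => g x a b) p) (hdet : (g p).det ≠ 0)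
    (hcrit : ∀ a b k, pd k (fun x => g x a b) p = 0) (a b k : Fin n) :
    pd k (ricciTensor g a b) p =
      ∑ i, (pd k (pd i (christoffel g i a b)) p - pd k (pd a (christoffel g i i b)) p) := by
  have hΓ := fun i a b => contDiffAt_christoffel hg hdet i a b
  have dΓ := fun i a b => differentiableAt_of_smooth (hΓ i a b)
  have dpΓ := fun i a b k => differentiableAt_of_smooth (contDiffAt_pd (hΓ i a b) k)
  have hΓ0 := fun i a b => christoffel_eq_zero hcrit i a b
  change pd k (fun x => ∑ i, (pd i (christoffel g i a b) x - pd a (christoffel g i i b) x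
    + ∑ j, (christoffel g j a b x * christoffel g i i j x
      - christoffel g i j a x * christoffel g j i b x))) p = _
  have dq : ∀ i j, DifferentiableAt ℝ (fun x => christoffel g j a b x * christoffel g i i j x
      - christoffel g i j a x * christoffel g j i b x) p := fun i j =>
    ((dΓ j a b).fun_mul (dΓ i i j)).fun_sub ((dΓ i j a).fun_mul (dΓ j i b))
  have dQ : ∀ i, DifferentiableAt ℝ (fun x => ∑ j, (christoffel g j a b x * christoffel g i i j x
      - christoffel g i j a x * christoffel g j i b x)) p := fun i =>
    DifferentiableAt.fun_sum fun j _ => dq i j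
  have dl : ∀ i, DifferentiableAt ℝ
      (fun x => pd i (christoffel g i a b) x - pd a (christoffel g i i b) x) p := fun i =>
    (dpΓ i a b i).fun_sub (dpΓ i i b a)
  rw [pd_sum _ _ fun i _ => (dl i).fun_add (dQ i)]
  refine Finset.sum_congr rfl fun i _ => ?_
  rw [pd_add _ (dl i) (dQ i), pd_sub _ (dpΓ i a b i) (dpΓ i i b a), pd_sum _ _ fun j _ => dq i j]
  rw [Finset.sum_eq_zero, add_zero]
  intro j _
  rw [pd_sub _ ((dΓ j a b).fun_mul (dΓ i i j)) ((dΓ i j a).fun_mul (dΓ j i b)),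
    pd_mul_eq_zero (dΓ j a b) (dΓ i i j) (hΓ0 _ _ _) (hΓ0 _ _ _),
    pd_mul_eq_zero (dΓ i j a) (dΓ j i b) (hΓ0 _ _ _) (hΓ0 _ _ _), sub_zero]

theorem sum_four_swap (F : Fin n → Fin n → Fin n → Fin n → ℝ) :
    ∑ a, ∑ b, ∑ i, ∑ c, F a b i c = ∑ a, ∑ b, ∑ i, ∑ c, F i c a b := by
  calc ∑ a, ∑ b, ∑ i, ∑ c, F a b i c = ∑ a, ∑ i, ∑ b, ∑ c, F a b i c :=
        Finset.sum_congr rfl fun a _ => Finset.sum_comm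
    _ = ∑ i, ∑ a, ∑ b, ∑ c, F a b i c := Finset.sum_comm
    _ = ∑ i, ∑ a, ∑ c, ∑ b, F a b i c :=
        Finset.sum_congr rfl fun i _ => Finset.sum_congr rfl fun a _ => Finset.sum_comm
    _ = ∑ i, ∑ c, ∑ a, ∑ b, F a b i c := Finset.sum_congr rfl fun i _ => Finset.sum_comm

/-- The algebra behind the contracted Bianchi identity: `T a b i j k` plays the role of
`∂ᵢ∂ⱼ∂ₖ g_ab`, and `r` that of `dρ`. -/
theorem contracted_bianchi (G H : Matrix (Fin n) (Fin n) ℝ) (hG : ∀ a b, G a b = G b a)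
    (hGH : G * H = 1) (T : Fin n → Fin n → Fin n → Fin n → Fin n → ℝ)
    (hT : ∀ a b i j k, T a b i j k = T b a i j k) (hT₁ : ∀ a b i j k, T a b i j k = T a b j i k)
    (hT₂ : ∀ a b i j k, T a b i j k = T a b i k j) (r : Fin n → ℝ)
    (hR : ∀ a b k, ∑ i, ∑ c, G i c * (1 / 2 * (T c b a i k + T a c b i k - T a b c i k
      - T c i a b k)) = r k * H a b) (m : Fin n) : ((n : ℝ) - 2) * r m = 0 := by
  have tr : ∑ a, ∑ b, G a b * H b a = n := by
    have := congrArg Matrix.trace hGH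
    simpa [Matrix.trace, Matrix.mul_apply] using this
  have hH : ∀ a b, H a b = H b a := by
    have h1 : H = G⁻¹ := (Matrix.inv_eq_right_inv hGH).symm
    have h2 : G.IsSymm := Matrix.IsSymm.ext fun a b => hG b a
    intro a b
    rw [h1]
    exact (h2.inv).apply b a
  -- The right-hand side of `hR` is contracted in two ways: `c1` is the derivative of the scalar
  -- curvature, `c2` the divergence of the Ricci tensor.
  have c1 : ∑ a, ∑ b, G a b * (r m * H a b) = n * r m := by
    rw [← tr, Finset.sum_mul]
    refine Finset.sum_congr rfl fun a _ => ?_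
    rw [Finset.sum_mul]
    exact Finset.sum_congr rfl fun b _ => by rw [hH a b]; ring
  have c2 : ∑ a, ∑ k, G a k * (r k * H a m) = r m := by
    rw [Finset.sum_comm]
    have : ∀ k, ∑ a, G a k * (r k * H a m) = r k * (1 : Matrix (Fin n) (Fin n) ℝ) k m := by
      intro k
      rw [← hGH, Matrix.mul_apply, Finset.mul_sum]
      exact Finset.sum_congr rfl fun a _ => by rw [hG a k]; ring
    simp [this, Matrix.one_apply]
  -- With `X = G_ab G_ic T a c b i m` and `Y = G_ab G_ic T c i a b m` (summed), relabelling indices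
  -- turns the trace into `X - Y` (`e1`, `e2`) and the divergence into `(X - Y) / 2` (`e3`, `e4`,
  -- `e5`).
  have key : ∑ a, ∑ b, G a b * (r m * H a b) = 2 * ∑ a, ∑ k, G a k * (r k * H a m) := by
    simp only [← hR]
    have e1 : ∑ a, ∑ b, ∑ i, ∑ c, G a b * (G i c * T a b c i m) =
        ∑ a, ∑ b, ∑ i, ∑ c, G a b * (G i c * T c i a b m) := by
      rw [sum_four_swap]
      refine Finset.sum_congr rfl fun a _ => Finset.sum_congr rfl fun b _ =>
        Finset.sum_congr rfl fun i _ => Finset.sum_congr rfl fun c _ => ?_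
      rw [hT i c b a m, hT₁ c i b a m]
      ring
    have e2 : ∑ a, ∑ b, ∑ i, ∑ c, G a b * (G i c * T c b a i m) =
        ∑ a, ∑ b, ∑ i, ∑ c, G a b * (G i c * T a c b i m) := by
      have : ∑ a, ∑ b, ∑ i, ∑ c, G a b * (G i c * T c b a i m) =
          ∑ b, ∑ a, ∑ i, ∑ c, G a b * (G i c * T c b a i m) := Finset.sum_comm
      rw [this]
      refine Finset.sum_congr rfl fun a _ => Finset.sum_congr rfl fun b _ =>
        Finset.sum_congr rfl fun i _ => Finset.sum_congr rfl fun c _ => ?_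
      rw [hT c a, hG b a]
    have e3 : ∑ a, ∑ b, ∑ i, ∑ c, G a b * (G i c * T c m a i b) =
        ∑ a, ∑ b, ∑ i, ∑ c, G a b * (G i c * T a m c i b) := by
      rw [sum_four_swap]
      rw [Finset.sum_comm]
      refine Finset.sum_congr rfl fun a _ => Finset.sum_congr rfl fun b _ =>
        Finset.sum_congr rfl fun i _ => Finset.sum_congr rfl fun c _ => ?_
      rw [hT₂ a m i b c, hT₁ a m i c b, hG b a]
      ring
    have e4 : ∑ a, ∑ b, ∑ i, ∑ c, G a b * (G i c * T a c m i b) =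
        ∑ a, ∑ b, ∑ i, ∑ c, G a b * (G i c * T a c b i m) := by
      refine Finset.sum_congr rfl fun a _ => Finset.sum_congr rfl fun b _ =>
        Finset.sum_congr rfl fun i _ => Finset.sum_congr rfl fun c _ => ?_
      rw [hT₁ a c m i b, hT₂ a c i m b, hT₁ a c i b m]
    have e5 : ∑ a, ∑ b, ∑ i, ∑ c, G a b * (G i c * T c i a m b) =
        ∑ a, ∑ b, ∑ i, ∑ c, G a b * (G i c * T c i a b m) := by
      refine Finset.sum_congr rfl fun a _ => Finset.sum_congr rfl fun b _ =>
        Finset.sum_congr rfl fun i _ => Finset.sum_congr rfl fun c _ => ?_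
      rw [hT₂ c i a m b]
    have l1 : ∀ a b, G a b * ∑ i, ∑ c, G i c * (1 / 2 * (T c b a i m + T a c b i m - T a b c i m
        - T c i a b m)) = 1 / 2 * (∑ i, ∑ c, G a b * (G i c * T c b a i m)
          + ∑ i, ∑ c, G a b * (G i c * T a c b i m) - ∑ i, ∑ c, G a b * (G i c * T a b c i m)
          - ∑ i, ∑ c, G a b * (G i c * T c i a b m)) := by
      intro a b
      simp only [Finset.mul_sum, ← Finset.sum_add_distrib, ← Finset.sum_sub_distrib]
      exact Finset.sum_congr rfl fun i _ => Finset.sum_congr rfl fun c _ => by ring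
    have l2 : ∀ a b, G a b * ∑ i, ∑ c, G i c * (1 / 2 * (T c m a i b + T a c m i b - T a m c i b
        - T c i a m b)) = 1 / 2 * (∑ i, ∑ c, G a b * (G i c * T c m a i b)
          + ∑ i, ∑ c, G a b * (G i c * T a c m i b) - ∑ i, ∑ c, G a b * (G i c * T a m c i b)
          - ∑ i, ∑ c, G a b * (G i c * T c i a m b)) := by
      intro a b
      simp only [Finset.mul_sum, ← Finset.sum_add_distrib, ← Finset.sum_sub_distrib]
      exact Finset.sum_congr rfl fun i _ => Finset.sum_congr rfl fun c _ => by ring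
    simp only [l1, l2, ← Finset.mul_sum, Finset.sum_add_distrib, Finset.sum_sub_distrib]
    simp only [← Finset.mul_sum] at e1 e2 e3 e4 e5
    linarith [e1, e2, e3, e4, e5]
  rw [c1, c2] at key
  linarith

/-- Schur's lemma: if the Ricci scalar of a quadratic metric is `ρ` times the metric, then `ρ` is
critical at every point where the first derivatives of the metric vanish. -/
theorem schur_of_critical (hn : 3 ≤ n) (hsymm : ∀ x, (g x).IsSymm)
    (hg : ∀ a b, ContDiffAt ℝ ∞ (fun x => g x a b) p) (hdet : (g p).det ≠ 0)
    (hcrit : ∀ a b k, pd k (fun x => g x a b) p = 0) {ρ : EuclideanSpace ℝ (Fin n) → ℝ}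
    (hρ : DifferentiableAt ℝ ρ p)
    {L : EuclideanSpace ℝ (Fin n) → EuclideanSpace ℝ (Fin n) → ℝ} {y₀ : EuclideanSpace ℝ (Fin n)}
    (hL : EqNear L (quadForm g) (p, y₀))
    (hRic : EqNear (coordRicci L) (fun x y => ρ x * L x y) (p, y₀)) (k : Fin n) :
    pd k ρ p = 0 := by
  have hΓ := fun i a b => contDiffAt_christoffel hg hdet i a b
  have hd := fun a b => differentiableAt_of_smooth (hg a b)
  have h1 : ∀ᶠ x in 𝓝 p, ∀ᶠ y in 𝓝 y₀,
      coordRicci (quadForm g) x y = ρ x * quadForm g x y := by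
    have : ∀ᶠ r in 𝓝 (p, y₀), coordRicci (quadForm g) r.1 r.2 = ρ r.1 * quadForm g r.1 r.2 := by
      filter_upwards [hL, hRic, hL.coordRicci] with r h1 h2 h3
      rw [← h3, h2, h1]
    rw [nhds_prod_eq] at this
    exact this.curry
  have hdΓ : ∀ᶠ x in 𝓝 p, ∀ i a b, DifferentiableAt ℝ (christoffel g i a b) x := by
    simp only [eventually_all]
    exact fun i a b => eventually_differentiableAt (hΓ i a b)
  -- Equality of the two quadratic forms for `y` near `y₀` determines only the symmetrized
  -- coefficients.
  have h2 : ∀ᶠ x in 𝓝 p, ∀ a b,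
      ricciTensor g a b x + ricciTensor g b a x = ρ x * (2 * g x a b) := by
    filter_upwards [h1, hdΓ] with x hx hx' a b
    have := symm_eq_zero_of_eventually (fun a b => ricciTensor g a b x - ρ x * g x a b) y₀ (by
      filter_upwards [hx] with y hy
      rw [coordRicci_quadForm hsymm hx', quadForm] at hy
      simp only [sub_mul, mul_assoc (ρ x), Finset.sum_sub_distrib, ← Finset.mul_sum, hy,
        sub_self]) a b
    rw [(hsymm x).apply a b] at this
    linarith
  have hgs : ∀ a b, (fun x => g x a b) = fun x => g x b a := fun a b =>
    funext fun x => (hsymm x).apply b a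
  set T : Fin n → Fin n → Fin n → Fin n → Fin n → ℝ :=
    fun a b i j l => pd l (pd j (pd i fun x => g x a b)) p with hTdef
  have hT : ∀ a b i j l, T a b i j l = T b a i j l := fun a b i j l => by
    simp only [hTdef, hgs a b]
  have hT₂ : ∀ a b i j l, T a b i j l = T a b i l j := fun a b i j l =>
    pd_comm (contDiffAt_two (contDiffAt_pd (hg a b) i)) l j
  have hT₁ : ∀ a b i j l, T a b i j l = T a b j i l := fun a b i j l => by
    refine pd_congr ?_ l
    have hs : ∀ᶠ x in 𝓝 p, ContDiffAt ℝ 2 (fun x => g x a b) x :=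
      (contDiffAt_two (hg a b)).eventually (by simp)
    filter_upwards [hs] with x hx using pd_comm hx j i
  have hG := (hsymm p).inv
  have hGinv : ∀ a b, (g p)⁻¹ a b = (g p)⁻¹ b a := fun a b => hG.apply b a
  have hdR : ∀ a b k, pd k (ricciTensor g a b) p = ∑ i, ∑ c, (g p)⁻¹ i c *
      (1 / 2 * (T c b a i k + T a c b i k - T a b c i k - T c i a b k)) := by
    intro a b k
    -- This part of the derivative of `Γⁱ_ib` is antisymmetric in `i, c` and dies against the
    -- symmetric inverse metric. What is left of that term is `(1/2) gⁱᶜ T c i a b k`.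
    have tr : ∑ i, ∑ c, (g p)⁻¹ i c * (1 / 2 * (T c b i a k - T i b c a k)) = 0 := by
      have h3 : ∑ i, ∑ c, (g p)⁻¹ i c * T c b i a k = ∑ i, ∑ c, (g p)⁻¹ i c * T i b c a k := by
        rw [Finset.sum_comm]
        exact Finset.sum_congr rfl fun i _ => Finset.sum_congr rfl fun c _ => by rw [hGinv]
      have h4 : ∑ i, ∑ c, (g p)⁻¹ i c * (1 / 2 * (T c b i a k - T i b c a k)) =
          1 / 2 * (∑ i, ∑ c, (g p)⁻¹ i c * T c b i a k - ∑ i, ∑ c, (g p)⁻¹ i c * T i b c a k) := by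
        simp only [Finset.mul_sum, ← Finset.sum_sub_distrib]
        exact Finset.sum_congr rfl fun i _ => Finset.sum_congr rfl fun c _ => by ring
      rw [h4, h3]
      ring
    rw [pd_ricciTensor hg hdet hcrit, ← add_zero (∑ i, _), ← tr]
    simp only [pd_pd_christoffel hg hdet hcrit, pd_pd_christoffelLow hg, ← Finset.sum_sub_distrib,
      ← Finset.sum_add_distrib]
    refine Finset.sum_congr rfl fun i _ => Finset.sum_congr rfl fun c _ => ?_
    change (g p)⁻¹ i c * (1 / 2 * (T c b a i k + T a c b i k - T a b c i k)) -
      (g p)⁻¹ i c * (1 / 2 * (T c b i a k + T i c b a k - T i b c a k)) +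
      (g p)⁻¹ i c * (1 / 2 * (T c b i a k - T i b c a k)) = _
    rw [hT i c b a k, hT₁ c i b a k]
    ring
  -- Needed to pass from the symmetrized Ricci tensor in `h2` to the Ricci tensor itself; symmetry
  -- of its first derivatives at `p` is enough.
  have hRsymm : ∀ a b k, pd k (ricciTensor g a b) p = pd k (ricciTensor g b a) p := by
    intro a b k
    rw [hdR, hdR]
    refine Finset.sum_congr rfl fun i _ => Finset.sum_congr rfl fun c _ => ?_
    rw [hT c b a i k, hT c a b i k, hT a b c i k, hT₁ c i a b k]
    ring
  have hRd : ∀ a b, DifferentiableAt ℝ (ricciTensor g a b) p := by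
    intro a b
    have : ContDiffAt ℝ ∞ (ricciTensor g a b) p :=
      ContDiffAt.sum fun i _ => ((contDiffAt_pd (hΓ i a b) i).sub (contDiffAt_pd (hΓ i i b) a)).add
        (ContDiffAt.sum fun j _ => ((hΓ j a b).mul (hΓ i i j)).sub ((hΓ i j a).mul (hΓ j i b)))
    exact differentiableAt_of_smooth this
  have hfin : ∀ a b k, ∑ i, ∑ c, (g p)⁻¹ i c *
      (1 / 2 * (T c b a i k + T a c b i k - T a b c i k - T c i a b k)) = pd k ρ p * g p a b := by
    intro a b k
    rw [← hdR]
    have h3 : (fun x => ricciTensor g a b x + ricciTensor g b a x) =ᶠ[𝓝 p]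
        fun x => ρ x * (2 * g x a b) := h2.mono fun x hx => hx a b
    have h4 := pd_congr h3 k
    rw [pd_add k (hRd a b) (hRd b a), pd_mul k hρ ((hd a b).const_mul 2),
      pd_const_mul k 2 (hd a b), hcrit, ← hRsymm a b k] at h4
    linarith
  have hmain := contracted_bianchi (g p)⁻¹ (g p) hGinv
    (Matrix.nonsing_inv_mul _ (Ne.isUnit hdet)) T hT hT₁ hT₂ (fun k => pd k ρ p) hfin k
  have hn' : (n : ℝ) - 2 ≠ 0 := by
    have : (3 : ℝ) ≤ n := by exact_mod_cast hn
    intro h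
    linarith
  exact (mul_eq_zero.1 hmain).resolve_left hn'

end Schur

/-! ### Natural charts -/

section NaturalCharts

open Bundle

variable {n : ℕ} {M : Type*} [TopologicalSpace M] [ChartedSpace (EuclideanSpace ℝ (Fin n)) M]

/-- The tangent vector `yⁱ ∂/∂xⁱ` at the point of coordinates `x` in the chart `e`. -/
noncomputable def natVec (e : OpenPartialHomeomorph M (EuclideanSpace ℝ (Fin n)))
    (x y : EuclideanSpace ℝ (Fin n)) : TangentBundle (𝓡 n) M :=
  ⟨e.symm x, mfderiv (𝓡 n) (𝓡 n) e.symm x y⟩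

theorem localExpr_eq (e : OpenPartialHomeomorph M (EuclideanSpace ℝ (Fin n)))
    (L : TangentBundle (𝓡 n) M → ℝ) (x y : EuclideanSpace ℝ (Fin n)) :
    localExpr e L x y = L (natVec e x y) := rfl

theorem natVec_proj (e : OpenPartialHomeomorph M (EuclideanSpace ℝ (Fin n)))
    (x y : EuclideanSpace ℝ (Fin n)) : (natVec e x y).proj = e.symm x := rfl

variable {e : OpenPartialHomeomorph M (EuclideanSpace ℝ (Fin n))}
  {x y : EuclideanSpace ℝ (Fin n)}

theorem mdifferentiable_of_mem_maximalAtlas (he : e ∈ IsManifold.maximalAtlas (𝓡 n) ∞ M) :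
    e.MDifferentiable (𝓡 n) (𝓡 n) :=
  ⟨(contMDiffOn_of_mem_maximalAtlas he).mdifferentiableOn (by simp),
    (contMDiffOn_symm_of_mem_maximalAtlas he).mdifferentiableOn (by simp)⟩

theorem fiberCoord_natVec (he : e ∈ IsManifold.maximalAtlas (𝓡 n) ∞ M) (hx : x ∈ e.target)
    (y : EuclideanSpace ℝ (Fin n)) : fiberCoord e (natVec e x y) = y := by
  have h := (mdifferentiable_of_mem_maximalAtlas he).comp_symm_deriv hx
  exact DFunLike.congr_fun h y

theorem coord_natVec (hx : x ∈ e.target) (y : EuclideanSpace ℝ (Fin n)) :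
    e (natVec e x y).proj = x := e.right_inv hx

theorem natVec_coord (he : e ∈ IsManifold.maximalAtlas (𝓡 n) ∞ M) (v : TangentBundle (𝓡 n) M)
    (hv : v.proj ∈ e.source) : natVec e (e v.proj) (fiberCoord e v) = v := by
  obtain ⟨x, u⟩ := v
  have h := DFunLike.congr_fun ((mdifferentiable_of_mem_maximalAtlas he).symm_comp_deriv hv) u
  have h2 : ∀ (z : M) (w : EuclideanSpace ℝ (Fin n)), z = x → w = u →
      (⟨z, w⟩ : TangentBundle (𝓡 n) M) = ⟨x, u⟩ := by
    rintro z w rfl rfl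
    rfl
  exact h2 _ _ (e.left_inv hv) h

theorem ricciScalar_natVec (he : e ∈ IsManifold.maximalAtlas (𝓡 n) ∞ M) (hx : x ∈ e.target)
    (L : TangentBundle (𝓡 n) M → ℝ) (y : EuclideanSpace ℝ (Fin n)) :
    ricciScalar e L (natVec e x y) = coordRicci (localExpr e L) x y := by
  rw [ricciScalar, coord_natVec hx, fiberCoord_natVec he hx]

theorem fundamentalTensor_natVec (he : e ∈ IsManifold.maximalAtlas (𝓡 n) ∞ M) (hx : x ∈ e.target)
    (L : TangentBundle (𝓡 n) M → ℝ) (y : EuclideanSpace ℝ (Fin n)) :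
    fundamentalTensor e L (natVec e x y) = fundamental (localExpr e L) x y := by
  rw [fundamentalTensor, coord_natVec hx, fiberCoord_natVec he hx]

/-- The coefficients of a `2`-covariant tensor field in the chart `e`. -/
noncomputable def coordTensor (e : OpenPartialHomeomorph M (EuclideanSpace ℝ (Fin n)))
    (h : ∀ x : M, TangentSpace (𝓡 n) x →L[ℝ] TangentSpace (𝓡 n) x →L[ℝ] ℝ)
    (x u w : EuclideanSpace ℝ (Fin n)) : ℝ :=
  h (e.symm x) (mfderiv (𝓡 n) (𝓡 n) e.symm x u) (mfderiv (𝓡 n) (𝓡 n) e.symm x w)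

theorem coordTensor_self (e : OpenPartialHomeomorph M (EuclideanSpace ℝ (Fin n)))
    (h : ∀ x : M, TangentSpace (𝓡 n) x →L[ℝ] TangentSpace (𝓡 n) x →L[ℝ] ℝ)
    (x y : EuclideanSpace ℝ (Fin n)) :
    h (natVec e x y).proj (natVec e x y).snd (natVec e x y).snd = coordTensor e h x y y := rfl

theorem bilin_sum (B : EuclideanSpace ℝ (Fin n) →L[ℝ] EuclideanSpace ℝ (Fin n) →L[ℝ] ℝ)
    (D : EuclideanSpace ℝ (Fin n) →L[ℝ] EuclideanSpace ℝ (Fin n))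
    (u w : EuclideanSpace ℝ (Fin n)) :
    B (D u) (D w) = ∑ a, ∑ b,
      B (D (EuclideanSpace.single a 1)) (D (EuclideanSpace.single b 1)) * u a * w b := by
  have hu := (EuclideanSpace.basisFun (Fin n) ℝ).sum_repr u
  have hw := (EuclideanSpace.basisFun (Fin n) ℝ).sum_repr w
  simp only [EuclideanSpace.basisFun_apply, EuclideanSpace.basisFun_repr] at hu hw
  conv_lhs => rw [← hu, ← hw]
  simp only [map_sum, map_smul, sum_apply, smul_apply,
    smul_eq_mul, Finset.mul_sum]
  rw [Finset.sum_comm]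
  exact Finset.sum_congr rfl fun a _ => Finset.sum_congr rfl fun b _ => by ring

theorem coordTensor_sum (e : OpenPartialHomeomorph M (EuclideanSpace ℝ (Fin n)))
    (h : ∀ x : M, TangentSpace (𝓡 n) x →L[ℝ] TangentSpace (𝓡 n) x →L[ℝ] ℝ)
    (x u w : EuclideanSpace ℝ (Fin n)) :
    coordTensor e h x u w = ∑ a, ∑ b,
      coordTensor e h x (EuclideanSpace.single a 1) (EuclideanSpace.single b 1) * u a * w b :=
  bilin_sum (h (e.symm x)) (mfderiv (𝓡 n) (𝓡 n) e.symm x) u w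

variable [IsManifold (𝓡 n) ∞ M]

/-- The tangent map within the target of a chart is smooth, and on an open set it is the full
tangent map. -/
theorem contMDiffOn_tangentMap_symm (he : e ∈ IsManifold.maximalAtlas (𝓡 n) ∞ M) :
    ContMDiffOn (𝓡 n).tangent (𝓡 n).tangent ∞ (tangentMap (𝓡 n) (𝓡 n) e.symm)
      (TotalSpace.proj ⁻¹' e.target) := by
  have h1 := (contMDiffOn_symm_of_mem_maximalAtlas he).contMDiffOn_tangentMapWithin (m := ∞)
    (by simp) e.open_target.uniqueMDiffOn
  refine h1.congr fun v hv => ?_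
  exact (tangentMapWithin_eq_tangentMap (e.open_target.uniqueMDiffOn v.proj hv)
    ((mdifferentiable_of_mem_maximalAtlas he).mdifferentiableAt_symm hv)).symm

theorem continuousAt_natVec (he : e ∈ IsManifold.maximalAtlas (𝓡 n) ∞ M) (hx : x ∈ e.target)
    (y : EuclideanSpace ℝ (Fin n)) :
    ContinuousAt (fun r : EuclideanSpace ℝ (Fin n) × EuclideanSpace ℝ (Fin n) => natVec e r.1 r.2)
      (x, y) := by
  have h1 := (contMDiffOn_tangentMap_symm he).continuousOn
  have ho : IsOpen (TotalSpace.proj ⁻¹' e.target :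
      Set (TangentBundle (𝓡 n) (EuclideanSpace ℝ (Fin n)))) :=
    e.open_target.preimage (FiberBundle.continuous_proj _ _)
  have h2 : ContinuousAt (tangentMap (𝓡 n) (𝓡 n) e.symm)
      ((tangentBundleModelSpaceHomeomorph (𝓡 n)).symm (x, y)) :=
    h1.continuousAt (ho.mem_nhds hx)
  exact ContinuousAt.comp (f := (tangentBundleModelSpaceHomeomorph (𝓡 n)).symm) h2
    (tangentBundleModelSpaceHomeomorph (𝓡 n)).symm.continuous.continuousAt

theorem contMDiffAt_natVec (he : e ∈ IsManifold.maximalAtlas (𝓡 n) ∞ M) (hx : x ∈ e.target)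
    (y : EuclideanSpace ℝ (Fin n)) :
    ContMDiffAt (𝓡 n) (𝓡 n).tangent ∞ (fun x' => natVec e x' y) x := by
  have ho : IsOpen (TotalSpace.proj ⁻¹' e.target :
      Set (TangentBundle (𝓡 n) (EuclideanSpace ℝ (Fin n)))) :=
    e.open_target.preimage (FiberBundle.continuous_proj _ _)
  have h1 : ContMDiffAt (𝓡 n) (𝓡 n).tangent ∞
      (fun x' => (⟨x', y⟩ : TangentBundle (𝓡 n) (EuclideanSpace ℝ (Fin n)))) x :=
    contMDiffAt_vectorSpace_iff_contDiffAt.2 contDiffAt_const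
  have h2 : ContMDiffAt (𝓡 n).tangent (𝓡 n).tangent ∞ (tangentMap (𝓡 n) (𝓡 n) e.symm)
      (⟨x, y⟩ : TangentBundle (𝓡 n) (EuclideanSpace ℝ (Fin n))) :=
    (contMDiffOn_tangentMap_symm he).contMDiffAt (ho.mem_nhds hx)
  exact h2.comp x h1

/-- The coefficients come from evaluating the smooth section on two vector fields with constant
components in the chart, which are smooth by `contMDiffAt_natVec`. -/
theorem contDiffAt_coordTensor
    {h : ∀ x : M, TangentSpace (𝓡 n) x →L[ℝ] TangentSpace (𝓡 n) x →L[ℝ] ℝ}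
    (hh : IsSmoothTensorField h) (he : e ∈ IsManifold.maximalAtlas (𝓡 n) ∞ M) (hx : x ∈ e.target)
    (u w : EuclideanSpace ℝ (Fin n)) :
    ContDiffAt ℝ ∞ (fun x => coordTensor e h x u w) x := by
  have hu := contMDiffAt_natVec he hx u
  have hw := contMDiffAt_natVec he hx w
  have hs : ContMDiffAt (𝓡 n) (𝓡 n) ∞ e.symm x := contMDiffAt_symm_of_mem_maximalAtlas he hx
  have hψ := (hh (e.symm x)).comp x hs
  have := ContMDiffAt.clm_bundle_apply₂ (F₁ := EuclideanSpace ℝ (Fin n))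
    (F₂ := EuclideanSpace ℝ (Fin n)) (F₃ := ℝ) (E₃ := Bundle.Trivial M ℝ) (b := e.symm)
    (ψ := fun x => h (e.symm x)) hψ hu hw
  have h2 := (contMDiffAt_totalSpace.1 this).2
  exact h2.contDiffAt

/-- A pseudo-Finsler metric does not vanish identically near any vector of its domain. -/
theorem frequently_localExpr_ne_zero [NeZero n] {A : Set (TangentBundle (𝓡 n) M)}
    {L : TangentBundle (𝓡 n) M → ℝ}
    (hL : IsPseudoFinslerMetric A L) (he : e ∈ IsManifold.maximalAtlas (𝓡 n) ∞ M)
    (hx : x ∈ e.target) (hA : natVec e x y ∈ A) : ∃ᶠ y' in 𝓝 y, localExpr e L x y' ≠ 0 := by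
  intro h
  have h0 : localExpr e L x =ᶠ[𝓝 y] fun _ => 0 := by
    filter_upwards [h] with y' hy'
    simpa using hy'
  apply hL.nondegenerate e he _ hA (e.map_target hx)
  rw [fundamentalTensor_natVec he hx]
  have h1 : fundamental (localExpr e L) x y = 0 := by
    ext i j
    have h2 : dy i (dy j (localExpr e L)) x y = pd i (pd j fun _ => 0) y :=
      pd_congr (pd_eventuallyEq h0 j) i
    rw [fundamental, Matrix.of_apply, h2, show (pd j fun _ : EuclideanSpace ℝ (Fin n) => (0 : ℝ)) =
      fun _ => 0 from funext fun _ => pd_const j 0, pd_const]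
    simp
  rw [h1]
  -- The zero matrix has zero determinant because `n ≠ 0`.
  exact Matrix.det_zero

theorem eventually_natVec_mem {A : Set (TangentBundle (𝓡 n) M)} (hA : IsOpen A)
    (he : e ∈ IsManifold.maximalAtlas (𝓡 n) ∞ M) (hx : x ∈ e.target) (hv : natVec e x y ∈ A) :
    ∀ᶠ r in 𝓝 (x, y), r.1 ∈ e.target ∧ natVec e r.1 r.2 ∈ A := by
  refine Filter.Eventually.and ?_ ((continuousAt_natVec he hx y).eventually (hA.mem_nhds hv))
  exact continuousAt_fst.eventually (e.open_target.mem_nhds hx)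

theorem continuousAt_localExpr {A : Set (TangentBundle (𝓡 n) M)} {L : TangentBundle (𝓡 n) M → ℝ}
    (hL : IsPseudoFinslerMetric A L) (he : e ∈ IsManifold.maximalAtlas (𝓡 n) ∞ M)
    (hx : x ∈ e.target) (hv : natVec e x y ∈ A) : ContinuousAt (localExpr e L x) y := by
  have h1 : ContinuousAt L (natVec e x y) :=
    hL.smooth.continuousOn.continuousAt (hL.domain.isOpen.mem_nhds hv)
  have h2 : ContinuousAt (fun y' => natVec e x y') y :=
    ContinuousAt.comp (f := fun y' => (x, y')) (continuousAt_natVec he hx y) (by fun_prop)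
  exact ContinuousAt.comp (f := fun y' => natVec e x y') h1 h2

theorem contDiffAt_localExpr {A : Set (TangentBundle (𝓡 n) M)} {L : TangentBundle (𝓡 n) M → ℝ}
    (hL : IsPseudoFinslerMetric A L) (he : e ∈ IsManifold.maximalAtlas (𝓡 n) ∞ M)
    (hx : x ∈ e.target) (hv : natVec e x y ∈ A) :
    ContDiffAt ℝ ∞ (fun x' => localExpr e L x' y) x := by
  have h1 : ContMDiffAt (𝓡 n).tangent 𝓘(ℝ, ℝ) ∞ L (natVec e x y) :=
    hL.smooth.contMDiffAt (hL.domain.isOpen.mem_nhds hv)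
  exact (h1.comp x (contMDiffAt_natVec he hx y)).contDiffAt

end NaturalCharts

/-! ### Smooth reparametrizations of charts -/

section Reparametrization

variable {n : ℕ} {M : Type*} [TopologicalSpace M] [ChartedSpace (EuclideanSpace ℝ (Fin n)) M]
  {e e' : OpenPartialHomeomorph M (EuclideanSpace ℝ (Fin n))}
  {φ : EuclideanSpace ℝ (Fin n) → EuclideanSpace ℝ (Fin n)} {q z : EuclideanSpace ℝ (Fin n)}

/-- A chart `e` can be precomposed with a smooth map `φ` which is a local diffeomorphism at `q`. -/
theorem exists_chart_comp [IsManifold (𝓡 n) ∞ M]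
    (he : e ∈ IsManifold.maximalAtlas (𝓡 n) ∞ M) (hφ : ContDiff ℝ ∞ φ)
    (hq : φ q ∈ e.target)
    (hd : HasFDerivAt φ ((ContinuousLinearEquiv.refl ℝ (EuclideanSpace ℝ (Fin n)) :
      EuclideanSpace ℝ (Fin n) →L[ℝ] EuclideanSpace ℝ (Fin n))) q) :
    ∃ e' ∈ IsManifold.maximalAtlas (𝓡 n) ∞ M, q ∈ e'.target ∧
      ∀ z ∈ e'.target, φ z ∈ e.target ∧ e'.symm z = e.symm (φ z) := by
  -- The source given by the inverse function theorem is cut down to the open set where the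
  -- derivative is invertible, so that the inverse is smooth on its whole domain and not just at one
  -- point.
  set S : Set (EuclideanSpace ℝ (Fin n)) := {z | fderiv ℝ φ z ∈ Set.range
    ((↑) : (EuclideanSpace ℝ (Fin n) ≃L[ℝ] EuclideanSpace ℝ (Fin n)) →
      EuclideanSpace ℝ (Fin n) →L[ℝ] EuclideanSpace ℝ (Fin n))} with hS
  have hSo : IsOpen S := (ContinuousLinearEquiv.isOpen).preimage (hφ.continuous_fderiv (by simp))
  set Φ := hφ.contDiffAt.toOpenPartialHomeomorph φ hd (by simp) with hΦ
  have hΦc : (Φ : _ → _) = φ := ContDiffAt.toOpenPartialHomeomorph_coe _ _ _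
  have hqΦ : q ∈ Φ.source := ContDiffAt.mem_toOpenPartialHomeomorph_source _ _ _
  set Ψ := Φ.restrOpen S hSo with hΨ
  have hΨc : (Ψ : _ → _) = φ := hΦc
  have hΨs : Ψ.source = Φ.source ∩ S := Φ.restrOpen_source S hSo
  have hqS : q ∈ S := ⟨_, hd.fderiv.symm⟩
  have hsymm : ContDiffOn ℝ ∞ Ψ.symm Ψ.target := by
    intro w hw
    have h1 : Ψ.symm w ∈ Φ.source ∩ S := hΨs ▸ Ψ.map_target hw
    obtain ⟨D, hD⟩ := h1.2
    refine (Ψ.contDiffAt_symm (f₀' := D) hw ?_ ?_).contDiffWithinAt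
    · rw [hΨc, hD]
      exact (hφ.differentiable (by simp) _).hasFDerivAt
    · rw [hΨc]
      exact hφ.contDiffAt
  refine ⟨e.trans Ψ.symm, ?_, ?_, ?_⟩
  · refine OpenPartialHomeomorph.mem_maximalAtlas_of_contMDiffOn _ ?_ ?_
    · rw [OpenPartialHomeomorph.coe_trans]
      refine hsymm.contMDiffOn.comp ((contMDiffOn_of_mem_maximalAtlas he).mono ?_) ?_
      · exact fun x hx => (e.trans_source Ψ.symm ▸ hx).1
      · exact fun x hx => (e.trans_source Ψ.symm ▸ hx).2
    · rw [OpenPartialHomeomorph.coe_trans_symm]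
      refine (contMDiffOn_symm_of_mem_maximalAtlas he).comp (t := e.target) ?_ ?_
      · rw [OpenPartialHomeomorph.symm_symm, hΨc]
        exact hφ.contMDiff.contMDiffOn
      · exact fun x hx => (e.trans_target Ψ.symm ▸ hx).2
  · rw [e.trans_target]
    refine ⟨?_, ?_⟩
    · change q ∈ Ψ.source
      exact hΨs ▸ ⟨hqΦ, hqS⟩
    · simpa [hΨc] using hq
  · intro z hz
    rw [e.trans_target] at hz
    have := hz.2
    simp only [OpenPartialHomeomorph.symm_symm, hΨc, Set.mem_preimage] at this
    refine ⟨this, ?_⟩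
    rw [OpenPartialHomeomorph.coe_trans_symm, OpenPartialHomeomorph.symm_symm, hΨc]
    rfl

/-- The chain rule for `e'.symm = e.symm ∘ φ`, which holds near `z`. -/
theorem coordTensor_comp (he : e ∈ IsManifold.maximalAtlas (𝓡 n) ∞ M)
    (hφ : ContDiff ℝ ∞ φ) (he' : ∀ z ∈ e'.target, φ z ∈ e.target ∧ e'.symm z = e.symm (φ z))
    (hz : z ∈ e'.target)
    (h : ∀ x : M, TangentSpace (𝓡 n) x →L[ℝ] TangentSpace (𝓡 n) x →L[ℝ] ℝ)
    (u w : EuclideanSpace ℝ (Fin n)) :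
    coordTensor e' h z u w = coordTensor e h (φ z) (fderiv ℝ φ z u) (fderiv ℝ φ z w) := by
  have h1 : e'.symm =ᶠ[𝓝 z] e.symm ∘ φ := by
    filter_upwards [e'.open_target.mem_nhds hz] with z' hz' using (he' z' hz').2
  have h2 : ∀ u : EuclideanSpace ℝ (Fin n), (mfderiv (𝓡 n) (𝓡 n) e'.symm z u :
      EuclideanSpace ℝ (Fin n)) = mfderiv (𝓡 n) (𝓡 n) e.symm (φ z) (fderiv ℝ φ z u) := by
    intro u
    have h3 := h1.mfderiv_eq (I := 𝓡 n) (I' := 𝓡 n)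
    have h4 := mfderiv_comp z (I := 𝓡 n) (I' := 𝓡 n) (I'' := 𝓡 n)
      ((mdifferentiable_of_mem_maximalAtlas he).mdifferentiableAt_symm (he' z hz).1)
      ((hφ.differentiable (by simp) z).mdifferentiableAt)
    rw [mfderiv_eq_fderiv] at h4
    exact DFunLike.congr_fun (h3.trans h4) u
  have h5 : ∀ (m m' : M) (u u' w w' : EuclideanSpace ℝ (Fin n)), m = m' → u = u' → w = w' →
      h m u w = h m' u' w' := by
    rintro m _ u _ w _ rfl rfl rfl
    rfl
  exact h5 _ _ _ _ _ _ (he' z hz).2 (h2 u) (h2 w)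

end Reparametrization

/-! ### Quadratic changes of coordinates -/

section NormalCoordinates

variable {n : ℕ}

/-- The quadratic change of coordinates `zⁱ ↦ pⁱ + zⁱ - (1/2) Cⁱ_ab zᵃ zᵇ`. -/
noncomputable def quadMap (C : Fin n → Fin n → Fin n → ℝ) (p z : EuclideanSpace ℝ (Fin n)) :
    EuclideanSpace ℝ (Fin n) :=
  WithLp.toLp 2 fun i => p i + z i - ∑ a, ∑ b, (1 / 2 * C i a b) * z a * z b

theorem quadMap_apply (C : Fin n → Fin n → Fin n → ℝ) (p z : EuclideanSpace ℝ (Fin n))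
    (i : Fin n) :
    quadMap C p z i = p i + z i - ∑ a, ∑ b, (1 / 2 * C i a b) * z a * z b := rfl

theorem contDiff_quadMap (C : Fin n → Fin n → Fin n → ℝ) (p : EuclideanSpace ℝ (Fin n)) :
    ContDiff ℝ ∞ (quadMap C p) := by
  rw [contDiff_euclidean]
  intro i
  simp only [quadMap_apply]
  fun_prop

theorem quadMap_zero (C : Fin n → Fin n → Fin n → ℝ) (p : EuclideanSpace ℝ (Fin n)) :
    quadMap C p 0 = p := by
  ext i
  simp [quadMap_apply]

theorem fderiv_quadMap (C : Fin n → Fin n → Fin n → ℝ) (hC : ∀ i a b, C i a b = C i b a)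
    (p z : EuclideanSpace ℝ (Fin n)) (i a : Fin n) :
    fderiv ℝ (quadMap C p) z (EuclideanSpace.single a 1) i =
      (if i = a then 1 else 0) - ∑ b, C i a b * z b := by
  have h1 : DifferentiableAt ℝ (quadMap C p) z :=
    (contDiff_quadMap C p).differentiable (by simp) z
  have h2 : HasFDerivAt (fun z => quadMap C p z i)
      ((EuclideanSpace.proj (𝕜 := ℝ) i).comp (fderiv ℝ (quadMap C p) z)) z :=
    (EuclideanSpace.proj (𝕜 := ℝ) i).hasFDerivAt.comp z h1.hasFDerivAt
  have h3 : fderiv ℝ (quadMap C p) z (EuclideanSpace.single a 1) i =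
      pd a (fun z => quadMap C p z i) z := by
    rw [pd, h2.fderiv]
    rfl
  rw [h3]
  simp only [quadMap_apply]
  rw [pd_sub _ (by fun_prop) (by fun_prop), pd_add _ (by fun_prop) (by fun_prop), pd_const,
    pd_coord, pd_bilin, zero_add]
  congr 1
  refine Finset.sum_congr rfl fun b _ => ?_
  rw [hC i b a]
  ring

theorem fderiv_quadMap_zero (C : Fin n → Fin n → Fin n → ℝ) (hC : ∀ i a b, C i a b = C i b a)
    (p : EuclideanSpace ℝ (Fin n)) :
    fderiv ℝ (quadMap C p) 0 = ContinuousLinearMap.id ℝ _ := by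
  apply ContinuousLinearMap.coe_injective
  refine (EuclideanSpace.basisFun (Fin n) ℝ).toBasis.ext fun a => ?_
  ext i
  simp [fderiv_quadMap C hC]

theorem pd_comp_quadMap (C : Fin n → Fin n → Fin n → ℝ) (hC : ∀ i a b, C i a b = C i b a)
    {p : EuclideanSpace ℝ (Fin n)} {f : EuclideanSpace ℝ (Fin n) → ℝ}
    (hf : DifferentiableAt ℝ f p) (k : Fin n) :
    pd k (fun z => f (quadMap C p z)) 0 = pd k f p := by
  have h1 : DifferentiableAt ℝ (quadMap C p) 0 :=
    (contDiff_quadMap C p).differentiable (by simp) 0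
  have hf' : DifferentiableAt ℝ f (quadMap C p 0) := by rwa [quadMap_zero]
  have h2 : fderiv ℝ (fun z => f (quadMap C p z)) 0 = _ :=
    fderiv_comp (0 : EuclideanSpace ℝ (Fin n)) hf' h1
  rw [pd, pd, h2, fderiv_quadMap_zero C hC, quadMap_zero]
  rfl

/-- In the coordinates given by `quadMap` with `C` the Christoffel symbols at `p`, the first
derivatives of the metric vanish. -/
theorem pd_pullback_eq_zero {g : EuclideanSpace ℝ (Fin n) → Matrix (Fin n) (Fin n) ℝ}
    {p : EuclideanSpace ℝ (Fin n)} (hsymm : ∀ x, (g x).IsSymm)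
    (hg : ∀ a b, DifferentiableAt ℝ (fun x => g x a b) p) (hdet : (g p).det ≠ 0)
    (C : Fin n → Fin n → Fin n → ℝ) (hC : ∀ i a b, C i a b = christoffel g i a b p)
    (a b k : Fin n) :
    pd k (fun z => ∑ c, ∑ d, g (quadMap C p z) c d *
      fderiv ℝ (quadMap C p) z (EuclideanSpace.single a 1) c *
      fderiv ℝ (quadMap C p) z (EuclideanSpace.single b 1) d) 0 = 0 := by
  have hCs : ∀ i a b, C i a b = C i b a := fun i a b => by
    rw [hC, hC, christoffel_comm hsymm]
  simp only [fderiv_quadMap C hCs]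
  have hJ : ∀ i a, DifferentiableAt ℝ (fun z : EuclideanSpace ℝ (Fin n) =>
      (if i = a then (1 : ℝ) else 0) - ∑ b, C i a b * z b) 0 := fun i a => by fun_prop
  have hJ' : ∀ i a, pd k (fun z : EuclideanSpace ℝ (Fin n) =>
      (if i = a then (1 : ℝ) else 0) - ∑ b, C i a b * z b) 0 = - C i a k := fun i a => by
    rw [pd_sub _ (by fun_prop) (by fun_prop), pd_const, pd_lin, zero_sub]
  have hgc : ∀ c d, DifferentiableAt ℝ (fun z => g (quadMap C p z) c d) 0 := by
    intro c d
    have h1 : DifferentiableAt ℝ (quadMap C p) 0 :=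
      (contDiff_quadMap C p).differentiable (by simp) 0
    have h2 : DifferentiableAt ℝ (fun x => g x c d) (quadMap C p 0) := by
      rw [quadMap_zero]
      exact hg c d
    exact h2.comp _ h1
  rw [pd_sum _ _ fun c _ => DifferentiableAt.fun_sum fun d _ =>
    ((hgc c d).fun_mul (hJ c a)).fun_mul (hJ d b)]
  have hterm : ∀ c, pd k (fun z => ∑ d, g (quadMap C p z) c d *
      ((if c = a then (1 : ℝ) else 0) - ∑ b, C c a b * z b) *
      ((if d = b then (1 : ℝ) else 0) - ∑ e, C d b e * z e)) 0 =
      ∑ d, (pd k (fun x => g x c d) p * (if c = a then 1 else 0) * (if d = b then 1 else 0)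
        - g p c d * C c a k * (if d = b then 1 else 0)
        - g p c d * (if c = a then 1 else 0) * C d b k) := by
    intro c
    rw [pd_sum _ _ fun d _ => ((hgc c d).fun_mul (hJ c a)).fun_mul (hJ d b)]
    refine Finset.sum_congr rfl fun d _ => ?_
    rw [pd_mul k ((hgc c d).fun_mul (hJ c a)) (hJ d b), pd_mul k (hgc c d) (hJ c a),
      hJ', hJ', pd_comp_quadMap C hCs (hg c d), quadMap_zero]
    simp only [PiLp.zero_apply, mul_zero, Finset.sum_const_zero, sub_zero]
    ring
  -- Lowering the index of `C` with the metric returns the symbols of the first kind.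
  have hlow : ∀ i a, ∑ c, g p i c * C c a k = christoffelLow g i a k p := by
    intro i a
    simp only [hC, christoffel, Finset.mul_sum]
    rw [Finset.sum_comm]
    have h1 : ∀ d, ∑ c, g p i c * ((g p)⁻¹ c d * christoffelLow g d a k p) =
        (1 : Matrix (Fin n) (Fin n) ℝ) i d * christoffelLow g d a k p := by
      intro d
      rw [← Matrix.mul_nonsing_inv _ (Ne.isUnit hdet), Matrix.mul_apply, Finset.sum_mul]
      exact Finset.sum_congr rfl fun c _ => by ring
    simp [h1, Matrix.one_apply]
  have hgs : ∀ a b, (fun x => g x a b) = fun x => g x b a := fun a b =>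
    funext fun x => (hsymm x).apply b a
  simp only [hterm, Finset.sum_sub_distrib]
  have s1 : ∑ c, ∑ d, pd k (fun x => g x c d) p * (if c = a then (1 : ℝ) else 0) *
      (if d = b then 1 else 0) = pd k (fun x => g x a b) p := by simp
  have s2 : ∑ c, ∑ d, g p c d * C c a k * (if d = b then (1 : ℝ) else 0) =
      christoffelLow g b a k p := by
    rw [← hlow]
    simp only [mul_ite, mul_one, mul_zero, Finset.sum_ite_eq', Finset.mem_univ, if_true]
    exact Finset.sum_congr rfl fun c _ => by rw [(hsymm p).apply b c]
  have s3 : ∑ c, ∑ d, g p c d * (if c = a then (1 : ℝ) else 0) * C d b k =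
      christoffelLow g a b k p := by
    rw [← hlow, Finset.sum_comm]
    simp
  -- What remains is `∂ₖ g_ab = Γ_b,ak + Γ_a,bk`, the compatibility of the Christoffel symbols with
  -- the metric.
  rw [s1, s2, s3, christoffelLow, christoffelLow, hgs b k, hgs b a, hgs a k]
  ring

end NormalCoordinates

/-! ### Einstein metrics with quadratic Ricci scalar -/

section Einstein

open Bundle

variable {n : ℕ} {M : Type*} [TopologicalSpace M] [ChartedSpace (EuclideanSpace ℝ (Fin n)) M]
  {A : Set (TangentBundle (𝓡 n) M)} {L : TangentBundle (𝓡 n) M → ℝ}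
  {h : ∀ x : M, TangentSpace (𝓡 n) x →L[ℝ] TangentSpace (𝓡 n) x →L[ℝ] ℝ} {ρ : M → ℝ}
  {e : OpenPartialHomeomorph M (EuclideanSpace ℝ (Fin n))} {p : EuclideanSpace ℝ (Fin n)}

/-- The coefficients in the chart `e` of the symmetric part of `h / ρ`. -/
noncomputable def coordMetric (e : OpenPartialHomeomorph M (EuclideanSpace ℝ (Fin n)))
    (h : ∀ x : M, TangentSpace (𝓡 n) x →L[ℝ] TangentSpace (𝓡 n) x →L[ℝ] ℝ) (ρ : M → ℝ)
    (x : EuclideanSpace ℝ (Fin n)) : Matrix (Fin n) (Fin n) ℝ :=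
  Matrix.of fun a b => (1 / 2 : ℝ) * (ρ (e.symm x))⁻¹ *
    (coordTensor e h x (EuclideanSpace.single a 1) (EuclideanSpace.single b 1) +
      coordTensor e h x (EuclideanSpace.single b 1) (EuclideanSpace.single a 1))

theorem coordMetric_isSymm (x : EuclideanSpace ℝ (Fin n)) : (coordMetric e h ρ x).IsSymm := by
  refine Matrix.IsSymm.ext fun a b => ?_
  simp only [coordMetric, Matrix.of_apply]
  ring

theorem bilin_coordMetric (x u w : EuclideanSpace ℝ (Fin n)) :
    ∑ a, ∑ b, coordMetric e h ρ x a b * u a * w b =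
      (1 / 2 : ℝ) * (ρ (e.symm x))⁻¹ * (coordTensor e h x u w + coordTensor e h x w u) := by
  rw [coordTensor_sum e h x u w, coordTensor_sum e h x w u, Finset.sum_comm (γ := Fin n)
    (f := fun a b => coordTensor e h x (EuclideanSpace.single a 1) (EuclideanSpace.single b 1)
      * w a * u b)]
  simp only [← Finset.sum_add_distrib, Finset.mul_sum]
  refine Finset.sum_congr rfl fun a _ => Finset.sum_congr rfl fun b _ => ?_
  simp only [coordMetric, Matrix.of_apply]
  ring

variable [IsManifold (𝓡 n) ∞ M]

/-- The Einstein condition extends by continuity to the zeros of `L`. -/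
theorem tensor_eq_mul [NeZero n] (hL : IsPseudoFinslerMetric A L)
    (hRic : RicciScalarEq A L fun v => h v.proj v.snd v.snd)
    (hρ : ∀ e ∈ IsManifold.maximalAtlas (𝓡 n) ∞ M, ∀ v ∈ A, v.proj ∈ e.source →
      L v ≠ 0 → ricciScalar e L v / L v = ρ v.proj) {v : TangentBundle (𝓡 n) M} (hv : v ∈ A) :
    h v.proj v.snd v.snd = ρ v.proj * L v := by
  set e := chartAt (EuclideanSpace ℝ (Fin n)) v.proj
  have he : e ∈ IsManifold.maximalAtlas (𝓡 n) ∞ M := IsManifold.chart_mem_maximalAtlas _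
  have hs : v.proj ∈ e.source := mem_chart_source _ _
  have hx : e v.proj ∈ e.target := e.map_source hs
  have hvn := natVec_coord he v hs
  set x := e v.proj
  set y := fiberCoord e v
  have hA : natVec e x y ∈ A := by rwa [hvn]
  have hev : ∀ᶠ y' in 𝓝 y, natVec e x y' ∈ A := by
    have hc : Tendsto (fun y' => (x, y')) (𝓝 y) (𝓝 (x, y)) := by
      rw [nhds_prod_eq]
      exact tendsto_const_nhds.prodMk tendsto_id
    exact (hc.eventually (eventually_natVec_mem hL.domain.isOpen he hx hA)).mono fun _ h => h.2
  have hcont : ContinuousAt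
      (fun y' => coordTensor e h x y' y' - ρ (e.symm x) * localExpr e L x y') y := by
    have h1 := continuousAt_localExpr hL he hx hA
    have h2 : ContinuousAt (fun y' => coordTensor e h x y' y') y := by
      rw [funext fun y' => coordTensor_sum e h x y' y']
      fun_prop
    exact h2.sub (continuousAt_const.mul h1)
  -- The difference vanishes at vectors arbitrarily close to `y`, namely those with `L ≠ 0`. Being
  -- continuous, it vanishes at `y`.
  have hfreq : ∃ᶠ y' in 𝓝 y, coordTensor e h x y' y' - ρ (e.symm x) * localExpr e L x y' = 0 := by
    refine ((frequently_localExpr_ne_zero hL he hx hA).and_eventually hev).mono ?_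
    rintro y' ⟨h1, h2⟩
    have hsrc : (natVec e x y').proj ∈ e.source := e.map_target hx
    have h3 := hρ e he _ h2 hsrc h1
    have h4 : ricciScalar e L (natVec e x y') = coordTensor e h x y' y' := hRic e he _ h2 hsrc
    rw [h4, ← localExpr_eq e L, div_eq_iff h1] at h3
    rw [h3, natVec_proj, sub_self]
  have hz : coordTensor e h x y y - ρ (e.symm x) * localExpr e L x y = 0 := by
    by_contra hne
    exact hfreq ((hcont.eventually_ne hne).mono fun _ h => h)
  rw [localExpr_eq, ← coordTensor_self, ← natVec_proj e x y, hvn] at hz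
  linarith

theorem exists_natVec_mem (hL : IsPseudoFinslerMetric A L)
    (he : e ∈ IsManifold.maximalAtlas (𝓡 n) ∞ M) (hp : p ∈ e.target) : ∃ y, natVec e p y ∈ A := by
  obtain ⟨v, hv, hvp⟩ := hL.domain.surj (e.symm p)
  have hs : v.proj ∈ e.source := hvp ▸ e.map_target hp
  refine ⟨fiberCoord e v, ?_⟩
  have h1 := natVec_coord he v hs
  rw [hvp, e.right_inv hp] at h1
  rwa [h1]

variable (hL : IsPseudoFinslerMetric A L) (hh : IsSmoothTensorField h)
  (hρ : ∀ v ∈ A, h v.proj v.snd v.snd = ρ v.proj * L v)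
  (he : e ∈ IsManifold.maximalAtlas (𝓡 n) ∞ M) (hp : p ∈ e.target)

include hL hh hρ he hp

/-- Fix components `y` with `L(p, y) ≠ 0`. Near `p` the factor equals `h(y, y) / L(x, y)`, a
quotient of smooth functions of `x`; this works also at the zeros of `ρ`. -/
theorem contDiffAt_factor [NeZero n] : ContDiffAt ℝ ∞ (fun x => ρ (e.symm x)) p := by
  obtain ⟨y₀, hy₀⟩ := exists_natVec_mem hL he hp
  have hc : Tendsto (fun y' => (p, y')) (𝓝 y₀) (𝓝 (p, y₀)) := by
    rw [nhds_prod_eq]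
    exact tendsto_const_nhds.prodMk tendsto_id
  obtain ⟨y, hy0, -, hyA⟩ := ((frequently_localExpr_ne_zero hL he hp hy₀).and_eventually
    (hc.eventually (eventually_natVec_mem hL.domain.isOpen he hp hy₀))).exists
  have h1 := contDiffAt_localExpr hL he hp hyA
  have h2 := contDiffAt_coordTensor hh he hp y y
  refine (h2.div h1 hy0).congr_of_eventuallyEq ?_
  have hc' : Tendsto (fun x' => (x', y)) (𝓝 p) (𝓝 (p, y)) := by
    rw [nhds_prod_eq]
    exact tendsto_id.prodMk tendsto_const_nhds
  filter_upwards [h1.continuousAt.eventually_ne hy0,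
    hc'.eventually (eventually_natVec_mem hL.domain.isOpen he hp hyA)] with x hx hxA
  have := hρ _ hxA.2
  rw [coordTensor_self] at this
  rw [Pi.div_apply, this, localExpr_eq]
  exact (mul_div_cancel_right₀ _ hx).symm

theorem contDiffAt_coordMetric [NeZero n] (h0 : ρ (e.symm p) ≠ 0) (a b : Fin n) :
    ContDiffAt ℝ ∞ (fun x => coordMetric e h ρ x a b) p :=
  (contDiffAt_const.mul ((contDiffAt_factor hL hh hρ he hp).inv h0)).mul
    ((contDiffAt_coordTensor hh he hp _ _).add (contDiffAt_coordTensor hh he hp _ _))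

theorem eqNear_quadForm [NeZero n] (h0 : ρ (e.symm p) ≠ 0) {y : EuclideanSpace ℝ (Fin n)}
    (hy : natVec e p y ∈ A) : EqNear (localExpr e L) (quadForm (coordMetric e h ρ)) (p, y) := by
  have h1 : ∀ᶠ r : EuclideanSpace ℝ (Fin n) × EuclideanSpace ℝ (Fin n) in 𝓝 (p, y),
      ρ (e.symm r.1) ≠ 0 :=
    (continuous_fst.tendsto (p, y)).eventually
      ((contDiffAt_factor hL hh hρ he hp).continuousAt.eventually_ne h0)
  filter_upwards [h1, eventually_natVec_mem hL.domain.isOpen he hp hy] with r h1 h2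
  have h3 := hρ _ h2.2
  rw [coordTensor_self, natVec_proj] at h3
  rw [quadForm, bilin_coordMetric, h3, localExpr_eq]
  field_simp
  ring

/-- The fundamental tensor of a quadratic form is its own matrix, so non-degeneracy is inherited
from `L`. -/
theorem det_coordMetric_ne_zero [NeZero n] (h0 : ρ (e.symm p) ≠ 0) :
    (coordMetric e h ρ p).det ≠ 0 := by
  obtain ⟨y, hy⟩ := exists_natVec_mem hL he hp
  have h1 := hL.nondegenerate e he _ hy (e.map_target hp)
  have h2 := (eqNear_quadForm hL hh hρ he hp h0 hy).fundamental.self_of_nhds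
  rw [fundamental_quadForm coordMetric_isSymm] at h2
  rwa [fundamentalTensor_natVec he hp, h2] at h1

omit hh in
theorem eqNear_coordRicci (hRic : RicciScalarEq A L fun v => h v.proj v.snd v.snd)
    {y : EuclideanSpace ℝ (Fin n)} (hy : natVec e p y ∈ A) :
    EqNear (coordRicci (localExpr e L)) (fun x y => ρ (e.symm x) * localExpr e L x y) (p, y) := by
  filter_upwards [eventually_natVec_mem hL.domain.isOpen he hp hy] with r hr
  have h1 : _ = h _ _ _ := hRic e he _ hr.2 (e.map_target hr.1)
  rw [hρ _ hr.2, ricciScalar_natVec he hr.1] at h1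
  exact h1

/-- The factor `ρ` is critical wherever it does not vanish. -/
theorem pd_factor_eq_zero (hn : 3 ≤ n) (hRic : RicciScalarEq A L fun v => h v.proj v.snd v.snd)
    (h0 : ρ (e.symm p) ≠ 0) (k : Fin n) : pd k (fun x => ρ (e.symm x)) p = 0 := by
  have : NeZero n := ⟨by omega⟩
  have hg := contDiffAt_coordMetric hL hh hρ he hp h0
  have hdet := det_coordMetric_ne_zero hL hh hρ he hp h0
  -- With these coefficients `quadMap C p` has derivative the identity at `0` and makes the metric
  -- critical there.
  set C : Fin n → Fin n → Fin n → ℝ := fun i a b => christoffel (coordMetric e h ρ) i a b p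
  have hC : ∀ i a b, C i a b = C i b a := fun i a b => by
    simp only [C, christoffel_comm coordMetric_isSymm i a b]
  have hφ := contDiff_quadMap C p
  have hd : HasFDerivAt (quadMap C p)
      ((ContinuousLinearEquiv.refl ℝ (EuclideanSpace ℝ (Fin n)) :
      EuclideanSpace ℝ (Fin n) →L[ℝ] EuclideanSpace ℝ (Fin n))) 0 := by
    have h1 := (hφ.differentiable (by simp) 0).hasFDerivAt
    rw [fderiv_quadMap_zero C hC] at h1
    exact h1
  obtain ⟨e', he', hp', hcomp⟩ := exists_chart_comp he hφ (by rwa [quadMap_zero]) hd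
  have hsymm0 : e'.symm 0 = e.symm p := by rw [(hcomp 0 hp').2, quadMap_zero]
  have h0' : ρ (e'.symm 0) ≠ 0 := by rwa [hsymm0]
  have hev : ∀ᶠ z in 𝓝 0, z ∈ e'.target := e'.open_target.mem_nhds hp'
  have hcrit : ∀ a b k, pd k (fun z => coordMetric e' h ρ z a b) 0 = 0 := by
    intro a b k
    rw [← pd_pullback_eq_zero coordMetric_isSymm (fun a b => differentiableAt_of_smooth (hg a b))
      hdet C (fun _ _ _ => rfl) a b k]
    refine pd_congr ?_ k
    filter_upwards [hev] with z hz
    rw [bilin_coordMetric, coordMetric, Matrix.of_apply, coordTensor_comp he hφ hcomp hz,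
      coordTensor_comp he hφ hcomp hz, (hcomp z hz).2]
  obtain ⟨y, hy⟩ := exists_natVec_mem hL he' hp'
  have hρ' := contDiffAt_factor hL hh hρ he' hp'
  have h1 := schur_of_critical hn coordMetric_isSymm
    (contDiffAt_coordMetric hL hh hρ he' hp' h0')
    (det_coordMetric_ne_zero hL hh hρ he' hp' h0') hcrit (differentiableAt_of_smooth hρ')
    (eqNear_quadForm hL hh hρ he' hp' h0' hy) (eqNear_coordRicci hL hρ he' hp' hRic hy) k
  -- Transport back to `e`: first derivatives at the origin are unchanged by `quadMap`.
  rw [← pd_comp_quadMap C hC (f := fun x => ρ (e.symm x))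
    (differentiableAt_of_smooth (contDiffAt_factor hL hh hρ he hp)), ← h1]
  refine pd_congr ?_ k
  filter_upwards [hev] with z hz
  rw [(hcomp z hz).2]

omit he hp

theorem continuous_factor [NeZero n] : Continuous ρ := by
  rw [continuous_iff_continuousAt]
  intro x
  have hx := mem_chart_source (EuclideanSpace ℝ (Fin n)) x
  have h1 := (contDiffAt_factor hL hh hρ (IsManifold.chart_mem_maximalAtlas x)
    ((chartAt (EuclideanSpace ℝ (Fin n)) x).map_source hx)).continuousAt
  have h2 := ContinuousAt.comp h1 ((chartAt (EuclideanSpace ℝ (Fin n)) x).continuousAt hx)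
  refine h2.congr ?_
  filter_upwards [(chartAt (EuclideanSpace ℝ (Fin n)) x).open_source.mem_nhds hx] with z hz
  simp [(chartAt (EuclideanSpace ℝ (Fin n)) x).left_inv hz]

/-- On a small coordinate ball `ρ` stays nonzero, so all its partial derivatives vanish there, and a
ball is connected. -/
theorem factor_eventually_const (hn : 3 ≤ n)
    (hRic : RicciScalarEq A L fun v => h v.proj v.snd v.snd) {x₀ : M} (h0 : ρ x₀ ≠ 0) :
    ∀ᶠ x in 𝓝 x₀, ρ x = ρ x₀ := by
  have : NeZero n := ⟨by omega⟩
  set e := chartAt (EuclideanSpace ℝ (Fin n)) x₀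
  have he : e ∈ IsManifold.maximalAtlas (𝓡 n) ∞ M := IsManifold.chart_mem_maximalAtlas _
  have hs : x₀ ∈ e.source := mem_chart_source _ _
  have hp : e x₀ ∈ e.target := e.map_source hs
  have h1 : ∀ᶠ z in 𝓝 (e x₀), z ∈ e.target ∧ ρ (e.symm z) ≠ 0 := by
    refine Filter.Eventually.and (e.open_target.mem_nhds hp) ?_
    refine (contDiffAt_factor hL hh hρ he hp).continuousAt.eventually_ne ?_
    rwa [e.left_inv hs]
  obtain ⟨r, hr, hball⟩ := Metric.eventually_nhds_iff_ball.1 h1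
  have hconst : ∀ z ∈ Metric.ball (e x₀) r, ρ (e.symm z) = ρ (e.symm (e x₀)) := by
    intro z hz
    refine Metric.isOpen_ball.is_const_of_fderiv_eq_zero (𝕜 := ℝ) (f := fun z => ρ (e.symm z))
      (convex_ball _ _).isPreconnected ?_ ?_ hz (Metric.mem_ball_self hr)
    · intro w hw
      exact (differentiableAt_of_smooth
        (contDiffAt_factor hL hh hρ he (hball w hw).1)).differentiableWithinAt
    · intro w hw
      apply ContinuousLinearMap.coe_injective
      refine (EuclideanSpace.basisFun (Fin n) ℝ).toBasis.ext fun a => ?_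
      have h2 := pd_factor_eq_zero hL hh hρ he (hball w hw).1 hn hRic (hball w hw).2 a
      rw [pd] at h2
      simpa using h2
  have h2 : ∀ᶠ x in 𝓝 x₀, e x ∈ Metric.ball (e x₀) r :=
    (e.continuousAt hs).eventually (Metric.ball_mem_nhds _ hr)
  filter_upwards [h2, e.open_source.mem_nhds hs] with x hx hxs
  have h3 := hconst _ hx
  rwa [e.left_inv hxs, e.left_inv hs] at h3

end Einstein

/-! ### Symmetrization of tensor fields -/

section Symmetrization

open Bundle

variable {n : ℕ} {M : Type*} [TopologicalSpace M] [ChartedSpace (EuclideanSpace ℝ (Fin n)) M]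

/-- The symmetrization of a bilinear form, multiplied by `r`. -/
noncomputable def symmetrize {V : Type*} [NormedAddCommGroup V] [NormedSpace ℝ V] (r : ℝ)
    (B : V →L[ℝ] V →L[ℝ] ℝ) : V →L[ℝ] V →L[ℝ] ℝ :=
  (1 / 2 * r) • (B + B.flip)

theorem symmetrize_apply {V : Type*} [NormedAddCommGroup V] [NormedSpace ℝ V] (r : ℝ)
    (B : V →L[ℝ] V →L[ℝ] ℝ) (u w : V) :
    symmetrize r B u w = 1 / 2 * r * (B u w + B w u) := rfl

theorem contMDiffAt_smul_add_isometry {W : Type*} [NormedAddCommGroup W] [NormedSpace ℝ W]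
    {f : M → W} {x : M} (hf : ContMDiffAt (𝓡 n) 𝓘(ℝ, W) ∞ f x) (r : ℝ) (σ : W ≃ₗᵢ[ℝ] W) :
    ContMDiffAt (𝓡 n) 𝓘(ℝ, W) ∞ (fun x => r • (f x + σ (f x))) x := by
  have h : ContDiff ℝ ∞ fun w => r • (w + σ w) := contDiff_const.smul (contDiff_id.add σ.contDiff)
  exact h.contMDiff.contMDiffAt.comp x hf

theorem contMDiffAt_symmetrize {V : Type*} [NormedAddCommGroup V] [NormedSpace ℝ V]
    {f : M → V →L[ℝ] V →L[ℝ] ℝ} {x : M}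
    (hf : ContMDiffAt (𝓡 n) 𝓘(ℝ, V →L[ℝ] V →L[ℝ] ℝ) ∞ f x) (r : ℝ) :
    ContMDiffAt (𝓡 n) 𝓘(ℝ, V →L[ℝ] V →L[ℝ] ℝ) ∞ (fun x => symmetrize r (f x)) x :=
  contMDiffAt_smul_add_isometry hf (1 / 2 * r) (ContinuousLinearMap.flipₗᵢ ℝ V V ℝ)

/-- The symmetrization of a tensor field, multiplied by `r`. -/
noncomputable def symmTensor (h : ∀ x : M, TangentSpace (𝓡 n) x →L[ℝ] TangentSpace (𝓡 n) x →L[ℝ] ℝ)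
    (r : ℝ) (x : M) : TangentSpace (𝓡 n) x →L[ℝ] TangentSpace (𝓡 n) x →L[ℝ] ℝ :=
  symmetrize (V := EuclideanSpace ℝ (Fin n)) r (h x)

theorem symmTensor_apply (h : ∀ x : M, TangentSpace (𝓡 n) x →L[ℝ] TangentSpace (𝓡 n) x →L[ℝ] ℝ)
    (r : ℝ) (x : M) (u w : TangentSpace (𝓡 n) x) :
    symmTensor h r x u w = 1 / 2 * r * (h x u w + h x w u) :=
  symmetrize_apply (V := EuclideanSpace ℝ (Fin n)) r _ u w

/-- In the local trivialization at `x₀` symmetrization is one fixed smooth operation on bilinear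
forms, since both arguments are trivialized by the same map. -/
theorem isSmoothTensorField_symmTensor [IsManifold (𝓡 n) ∞ M]
    {h : ∀ x : M, TangentSpace (𝓡 n) x →L[ℝ] TangentSpace (𝓡 n) x →L[ℝ] ℝ}
    (hh : IsSmoothTensorField h) (r : ℝ) : IsSmoothTensorField (symmTensor h r) := by
  intro x₀
  have h1 := (contMDiffAt_section x₀).1 (hh x₀)
  refine (contMDiffAt_section x₀).2 ?_
  have h2 := contMDiffAt_symmetrize h1 r
  refine h2.congr_of_eventuallyEq ?_
  have hb := (trivializationAt (EuclideanSpace ℝ (Fin n))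
    (TangentSpace (𝓡 n)) x₀).open_baseSet.mem_nhds
    (mem_baseSet_trivializationAt (EuclideanSpace ℝ (Fin n)) (TangentSpace (𝓡 n)) x₀)
  filter_upwards [hb] with x hx
  ext u w
  simp only [hom_trivializationAt_apply]
  rw [symmetrize_apply]
  rw [inCoordinates_apply_eq₂ hx hx (by trivial), inCoordinates_apply_eq₂ hx hx (by trivial),
    inCoordinates_apply_eq₂ hx hx (by trivial), symmTensor_apply]
  simp

end Symmetrization

/-! ### Constant nonzero factor and conclusion -/

theorem isPseudoRiemannian_of_factor_const {n : ℕ} [NeZero n] {M : Type*} [TopologicalSpace M]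
    [ChartedSpace (EuclideanSpace ℝ (Fin n)) M] [IsManifold (𝓡 n) ∞ M]
    {A : Set (TangentBundle (𝓡 n) M)} {L : TangentBundle (𝓡 n) M → ℝ}
    {h : ∀ x : M, TangentSpace (𝓡 n) x →L[ℝ] TangentSpace (𝓡 n) x →L[ℝ] ℝ}
    (hL : IsPseudoFinslerMetric A L) (hh : IsSmoothTensorField h) {c : ℝ} (hc : c ≠ 0)
    (hρ : ∀ v ∈ A, h v.proj v.snd v.snd = c * L v) : IsPseudoRiemannian A L := by
  refine ⟨symmTensor h c⁻¹, isSmoothTensorField_symmTensor hh _, ?_, ?_, ?_⟩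
  · intro x u w
    rw [symmTensor_apply, symmTensor_apply]
    ring
  · intro x u hu
    set e := chartAt (EuclideanSpace ℝ (Fin n)) x
    have he : e ∈ IsManifold.maximalAtlas (𝓡 n) ∞ M := IsManifold.chart_mem_maximalAtlas _
    have hs : x ∈ e.source := mem_chart_source _ _
    have hp : e x ∈ e.target := e.map_source hs
    -- In the chart, `symmTensor h c⁻¹` has the matrix `coordMetric` for the constant factor `c`, so
    -- a vector in its kernel has zero coordinates.
    have hdet := det_coordMetric_ne_zero (ρ := fun _ => c) hL hh hρ he hp hc
    have hv := natVec_coord he ⟨x, u⟩ hs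
    set y := fiberCoord e (⟨x, u⟩ : TangentBundle (𝓡 n) M)
    have hy : ∀ w : EuclideanSpace ℝ (Fin n), coordTensor e h (e x) y w +
        coordTensor e h (e x) w y = 0 := by
      have key : ∀ v : TangentBundle (𝓡 n) M, v = ⟨x, u⟩ → ∀ w : TangentSpace (𝓡 n) v.proj,
          h v.proj v.snd w + h v.proj w v.snd = 0 := by
        rintro _ rfl w
        have := hu w
        rw [symmTensor_apply] at this
        exact (mul_eq_zero.1 this).resolve_left (mul_ne_zero (by norm_num) (inv_ne_zero hc))
      exact fun w => key _ hv _
    have hy0 : y = 0 := by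
      have h1 : Matrix.vecMul (fun a => y a) (coordMetric e h (fun _ => c) (e x)) = 0 := by
        ext b
        have h2 := bilin_coordMetric (e := e) (h := h) (ρ := fun _ => c) (e x) y
          (EuclideanSpace.single b 1)
        rw [hy, mul_zero] at h2
        rw [Pi.zero_apply, ← h2]
        simp [Matrix.vecMul, dotProduct, mul_comm]
      have h3 := Matrix.eq_zero_of_vecMul_eq_zero hdet h1
      ext a
      exact congrFun h3 a
    have h4 : ∀ v : TangentBundle (𝓡 n) M, v = ⟨x, u⟩ → v.snd = 0 → u = 0 := by
      rintro _ rfl h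
      exact h
    refine h4 _ hv ?_
    rw [hy0]
    exact map_zero (mfderiv (𝓡 n) (𝓡 n) e.symm (e x))
  · intro v hv
    rw [symmTensor_apply, hρ v hv]
    field_simp
    ring

end PseudoFinsler

theorem theorem4p3 {n : ℕ} (hn : 3 ≤ n) {M : Type*} [TopologicalSpace M] [ConnectedSpace M]
    [ChartedSpace (EuclideanSpace ℝ (Fin n)) M] [IsManifold (𝓡 n) ∞ M]
    (A : Set (TangentBundle (𝓡 n) M)) (L : TangentBundle (𝓡 n) M → ℝ)
    (hL : PseudoFinsler.IsPseudoFinslerMetric A L)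
    (hquad : PseudoFinsler.HasQuadraticRicci A L)
    (hEinstein : PseudoFinsler.IsEinstein A L) :
    PseudoFinsler.RicciScalarEq A L (fun _ => 0) ∨
      (PseudoFinsler.IsPseudoRiemannian A L ∧
        ∃ c : ℝ, PseudoFinsler.RicciScalarEq A L fun v => c * L v) := by
  have : NeZero n := ⟨by omega⟩
  obtain ⟨h, hh, hRic⟩ := hquad
  obtain ⟨ρ, hE⟩ := hEinstein
  have hρ : ∀ v ∈ A, h v.proj v.snd v.snd = ρ v.proj * L v := fun v hv =>
    PseudoFinsler.tensor_eq_mul hL hRic hE hv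
  by_cases h0 : ∀ x, ρ x = 0
  · left
    intro e he v hv hs
    exact (hRic e he v hv hs).trans ((hρ v hv).trans (by rw [h0, zero_mul]))
  · right
    push Not at h0
    obtain ⟨x₁, hx₁⟩ := h0
    have hclosed : IsClosed {x | ρ x = ρ x₁} :=
      isClosed_eq (PseudoFinsler.continuous_factor hL hh hρ) continuous_const
    -- Local constancy is available at every point of this level set because its value `ρ x₁` is
    -- nonzero.
    have hopen : IsOpen {x | ρ x = ρ x₁} := by
      rw [isOpen_iff_eventually]
      intro x (hx : ρ x = ρ x₁)
      have h2 := PseudoFinsler.factor_eventually_const hL hh hρ hn hRic (x₀ := x) (by rwa [hx])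
      exact h2.mono fun z hz => hz.trans hx
    have huniv : {x | ρ x = ρ x₁} = Set.univ := IsClopen.eq_univ ⟨hclosed, hopen⟩ ⟨x₁, rfl⟩
    have hconst : ∀ x, ρ x = ρ x₁ := fun x => Set.eq_univ_iff_forall.1 huniv x
    have hρ' : ∀ v ∈ A, h v.proj v.snd v.snd = ρ x₁ * L v := fun v hv => by
      rw [hρ v hv, hconst]
    refine ⟨PseudoFinsler.isPseudoRiemannian_of_factor_const hL hh hx₁ hρ', ρ x₁, ?_⟩
    intro e he v hv hs
    exact (hRic e he v hv hs).trans (hρ' v hv)
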